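/- Let $k$ be an algebraically closed field of characteristic $0$ and let $H$ be a semisimple Hopf algebra over $k$, with comultiplication $\Delta(h)=\sum h_1\otimes h_2$, counit $\varepsilon$ and antipode $S$. Let $H^*$ be the dual algebra, with the convolution product $\langle pq,h\rangle=\sum\langle p,h_1\rangle\langle q,h_2\rangle$ and antipode $s(x)=x\circ S$. For $a,h\in H$ and $p,x\in H^*$ put $\langle a\rightharpoonup p,h\rangle=\langle p,ha\rangle$ and $x\rightharpoonup h=\sum\langle x,h_2\rangle h_1$. For a $k$-algebra $A$ let $R(A)\subseteq A^*$ be the $k$-span of the characters of the finite-dimensional irreducible $A$-modules. Let $N\subseteq H$ be a normal left coideal subalgebra, that is, a subalgebra with $\Delta(N)\subseteq H\otimes N$ and $\sum h_1nS(h_2)\in N$ for all $h\in H$, $n\in N$. Let $B=(H^*)^N=\{p\in H^* : n\rightharpoonup p=\langle\varepsilon,n\rangle p\ \text{ for all } n\in N\}$. An integral of $B$ is an element $\lambda\in B$ with $b\lambda=\langle b,1\rangle\lambda=\lambda b$ for all $b\in B$. Then there is a unique $k$-linear map $\phi\mapsto\phi^{\uparrow H}$ from $R(N)$ to $H^*$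 that sends the character of each irreducible $N$-module $V$ to the character of the induced $H$-module $H\otimes_N V$; the space $B$ has a nonzero integral; and for every nonzero integral $\lambda_B$ of $B$, $$\{\phi^{\uparrow H} : \phi\in R(N)\}=R(H)\lambda_B=\{x\in R(H) : s(x)\rightharpoonup H\subseteq N\},$$ where $R(H)\lambda_B=\{x\lambda_B : x\in R(H)\}$ and $s(x)\rightharpoonup H=\{s(x)\rightharpoonup h : h\in H\}$. -/

import Mathlib

open scoped TensorProduct

universe u v w

noncomputable section

namespace SemisimpleHopf

section Characters

variable (k : Type u) [Field k] (A : Type v) [Ring A] [Algebra k A]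

/-- The character `a ↦ tr (v ↦ a • v)` of an `A`-module `V` over the field `k`
(used for finite-dimensional `V`). -/
def character (V : Type w) [AddCommGroup V] [Module k V] [Module A V] [IsScalarTower k A V] :
    A →ₗ[k] k :=
  LinearMap.trace k V ∘ₗ (Algebra.lsmul k k V : A →ₐ[k] Module.End k V).toLinearMap

/-- The characters of the finite-dimensional irreducible `A`-modules. Every irreducible module is a
quotient of `A`, so modules in the universe of `A` give all of them. -/
def irreducibleCharacters : Set (A →ₗ[k] k) :=
  {χ | ∃ (V : Type v) (_ : AddCommGroup V) (_ : Module k V) (_ : Module A V)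
    (_ : IsScalarTower k A V),
    IsSimpleModule A V ∧ FiniteDimensional k V ∧ χ = character k A V}

/-- `R(A)`: the `k`-span of the irreducible characters of `A`. -/
def characterSpace : Submodule k (A →ₗ[k] k) :=
  Submodule.span k (irreducibleCharacters k A)

variable {A} in
theorem character_mem_characterSpace (V : Type v) [AddCommGroup V] [Module k V] [Module A V]
    [IsScalarTower k A V] [hs : IsSimpleModule A V] [hf : FiniteDimensional k V] :
    character k A V ∈ characterSpace k A :=
  Submodule.subset_span ⟨V, _, _, _, ‹_›, hs, hf, rfl⟩

end Characters

section Induction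

variable {k : Type u} [Field k] {H : Type v} [Ring H] [Algebra k H] (N : Subalgebra k H)
variable (V : Type w) [AddCommGroup V] [Module k V] [Module N V]

/-- The `H`-submodule of `H ⊗ₖ V` generated by the elements `h n ⊗ v - h ⊗ n v`, `n ∈ N`. -/
def balancedRelations : Submodule H (H ⊗[k] V) :=
  Submodule.span H
    {t | ∃ (h : H) (n : N) (v : V), t = (h * (n : H)) ⊗ₜ[k] v - h ⊗ₜ[k] (n • v)}

/-- The induced `H`-module `H ⊗_N V`, as the quotient of `H ⊗ₖ V` by the balancing relations
(the tensor product over a noncommutative ring). -/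
abbrev InducedModule : Type (max v w) := (H ⊗[k] V) ⧸ balancedRelations N V

end Induction

section Hopf

variable (k : Type u) [Field k] (H : Type v) [Ring H] [HopfAlgebra k H]

/-- The dual algebra `H^*`: linear functionals on `H` with the convolution product
`⟨p q, h⟩ = ∑ ⟨p, h₁⟩ ⟨q, h₂⟩`. -/
abbrev DualAlgebra : Type (max u v) := WithConv (H →ₗ[k] k)

/-- The character algebra `R(H)`, inside `H^*`. -/
def characterAlgebra : Submodule k (DualAlgebra k H) :=
  (characterSpace k H).comap (WithConv.linearEquiv k (H →ₗ[k] k)).toLinearMap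

variable {k H}

/-- The antipode `s` of `H^*`: `⟨s(x), h⟩ = ⟨x, S h⟩`. -/
def dualAntipode (x : DualAlgebra k H) : DualAlgebra k H :=
  WithConv.toConv (x.ofConv ∘ₗ HopfAlgebra.antipode k)

/-- The left hit action of `H^*` on `H`: `x ⇀ h = ∑ ⟨x, h₂⟩ h₁`. -/
def hit (x : DualAlgebra k H) (h : H) : H :=
  TensorProduct.rid k H (x.ofConv.lTensor H (Coalgebra.comul (R := k) h))

/-- The left hit action of `H` on `H^*`: `⟨a ⇀ p, h⟩ = ⟨p, h a⟩`. -/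
def dualHit (a : H) (p : DualAlgebra k H) : DualAlgebra k H :=
  WithConv.toConv (p.ofConv ∘ₗ LinearMap.mulRight k a)

variable (k) in
/-- The left adjoint action of `H` on itself: `h · a = ∑ h₁ a S(h₂)`. -/
def leftAdjoint (h a : H) : H :=
  LinearMap.mul' k H
    (TensorProduct.map (LinearMap.mulRight k a) (HopfAlgebra.antipode k)
      (Coalgebra.comul (R := k) h))

/-- The subalgebra `N` is a left coideal: `Δ(N) ⊆ H ⊗ N`. -/
def IsLeftCoideal (N : Subalgebra k H) : Prop :=
  ∀ n ∈ N, Coalgebra.comul (R := k) n ∈ LinearMap.range (N.val.toLinearMap.lTensor H)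

/-- `N` is stable under the left adjoint action of `H`. -/
def IsNormal (N : Subalgebra k H) : Prop :=
  ∀ h : H, ∀ n ∈ N, leftAdjoint k h n ∈ N

/-- `B = (H^*)^N`: the functionals `p` with `n ⇀ p = ⟨ε, n⟩ p` for all `n ∈ N`. -/
def dualInvariants (N : Subalgebra k H) : Submodule k (DualAlgebra k H) where
  carrier := {p | ∀ n ∈ N, dualHit n p = Coalgebra.counit (R := k) n • p}
  zero_mem' := fun n _ => by ext; simp [dualHit]
  add_mem' := fun {p q} hp hq n hn => by
    have h : dualHit n (p + q) = dualHit n p + dualHit n q := rfl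
    rw [h, hp n hn, hq n hn, smul_add]
  smul_mem' := fun c p hp n hn => by
    have h : dualHit n (c • p) = c • dualHit n p := rfl
    rw [h, hp n hn, smul_comm]

/-- `l` is a two-sided integral of `B ⊆ H^*`: `l ∈ B` and `b l = ⟨b, 1⟩ l = l b` for all `b ∈ B`. -/
def IsDualIntegral (B : Submodule k (DualAlgebra k H)) (l : DualAlgebra k H) : Prop :=
  l ∈ B ∧ ∀ b ∈ B, b * l = b.ofConv 1 • l ∧ l * b = b.ofConv 1 • l

/-- `ind` is the linear extension to `R(N)` of induction of irreducible characters, i.e. it sends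
the character of each irreducible `N`-module `V` to the character of `H ⊗_N V`. -/
def IsCharacterInduction (N : Subalgebra k H)
    (ind : characterSpace k N →ₗ[k] DualAlgebra k H) : Prop :=
  ∀ (V : Type v) [AddCommGroup V] [Module k V] [Module N V] [IsScalarTower k N V]
    [IsSimpleModule N V] [FiniteDimensional k V],
    ind ⟨character k N V, character_mem_characterSpace k V⟩ =
      WithConv.toConv (character k H (InducedModule N V))

end Hopf

end SemisimpleHopf

end

/-! All three sets equal `centralTranslates`, the set of functionals λ(· w) with w in N ∩ Z(H),
where λ is the symmetric Frobenius form of H.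

Let Λ be the integral of H with ε(Λ) = 1 and λ(h) = tr(x ↦ S²(x)h), an integral of H^* with λ(Λ) =
1. Then w ↦ λ(· w) is a bijection from H to H^*. By Larson–Radford S² = id, so λ(h) is the trace of
right multiplication by h and λ is symmetric. Hence class functions correspond to central elements
w. Larson–Radford is proved here from Radford's formula for S⁴ and a positivity argument for traces.

The form λ stays nondegenerate on N (`eq_zero_of_antipodeTrace_mul`): its radical is a nil ideal of
N stable under the coaction, and such an ideal is killed by ε. So N is semisimple, ε on N equals λ(e
·) for some e in N, and Δ(e) = ∑ S(cᵢ) ⊗ bᵢ with dual bases b, c of N (`exists_isCasimir`). The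
functional λ(· e) is an integral of B with value 1 at 1, so every integral is a multiple of it.
Normality of N makes e central in H.

Induction: ε(e)⁻¹ ∑ cᵢ ⊗ bᵢ is a separability idempotent of N, so H ⊗_N V is a direct summand of H ⊗
V, and its character is computed as a trace. The trace formula for λ turns it into λ(· w), with w =
ε(e)⁻¹ ∑ φ(bᵢ) ad_Λ(cᵢ) in N ∩ Z(H), where ad is the left adjoint action. Every w in N ∩ Z(H)
arises, from φ = ε(e) λ(w ·).

Multiplication by the integral: λ(· w) λ(· e) = λ(· w'), with w' the orthogonal projection of w to
N. Hit action: for x = λ(· w), s(x) ⇀ h = λ(S(w₁)h) w₂, which lies in N for w in N and equals w at h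
= Λ. -/

namespace SemisimpleHopf

/-! ### Convolution identities for the antipode -/

section Convolution

open WithConv Coalgebra HopfAlgebra

variable {k : Type u} [Field k] {H : Type v} [Ring H] [HopfAlgebra k H]

variable (k H) in
/-- `a ↦ a ⊗ 1` in the convolution algebra `Hom(H, H ⊗ H)`. -/
noncomputable def convLeft : WithConv (H →ₗ[k] H ⊗[k] H) :=
  toConv (Algebra.TensorProduct.includeLeft : H →ₐ[k] H ⊗[k] H).toLinearMap

variable (k H) in
/-- `a ↦ 1 ⊗ a` in the convolution algebra `Hom(H, H ⊗ H)`. -/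
noncomputable def convRight : WithConv (H →ₗ[k] H ⊗[k] H) :=
  toConv (Algebra.TensorProduct.includeRight : H →ₐ[k] H ⊗[k] H).toLinearMap

/-- Precomposition of an element of a convolution algebra with the antipode. -/
noncomputable def convAntipode {M : Type*} [AddCommGroup M] [Module k M]
    (f : WithConv (H →ₗ[k] M)) : WithConv (H →ₗ[k] M) :=
  toConv (f.ofConv ∘ₗ antipode k)

/-- Algebra maps are invertible for convolution. This turns the Sweedler identities below into
cancellations in a monoid. -/
theorem convAntipode_algHom_mul {A : Type*} [Ring A] [Algebra k A] (f : H →ₐ[k] A) :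
    convAntipode (toConv f.toLinearMap) * toConv f.toLinearMap = 1 := by
  ext a
  simp only [(ℛ k a).convMul_apply, convAntipode, LinearMap.comp_apply,
    AlgHom.toLinearMap_apply, ← map_mul, ← map_sum, sum_antipode_mul_eq_algebraMap_counit]
  simp

theorem algHom_mul_convAntipode {A : Type*} [Ring A] [Algebra k A] (f : H →ₐ[k] A) :
    toConv f.toLinearMap * convAntipode (toConv f.toLinearMap) = 1 := by
  ext a
  simp only [(ℛ k a).convMul_apply, convAntipode, LinearMap.comp_apply,
    AlgHom.toLinearMap_apply, ← map_mul, ← map_sum, sum_mul_antipode_eq_algebraMap_counit]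
  simp

variable (k H) in
theorem convLeft_mul_convRight :
    convLeft k H * convRight k H = toConv (Bialgebra.comulAlgHom k H).toLinearMap := by
  ext a
  simp [(ℛ k a).convMul_apply, convLeft, convRight, (ℛ k a).eq]

variable (k H) in
-- Both sides are convolution inverses of Δ: the left one because Δ is an algebra map, the right one
-- because Δ is the product of the two embeddings a ↦ a ⊗ 1 and a ↦ 1 ⊗ a.
theorem convAntipode_comul :
    convAntipode (toConv (Bialgebra.comulAlgHom k H).toLinearMap) =
      convAntipode (convRight k H) * convAntipode (convLeft k H) := by
  refine left_inv_eq_right_inv (convAntipode_algHom_mul (Bialgebra.comulAlgHom k H)) ?_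
  rw [← convLeft_mul_convRight, mul_assoc, ← mul_assoc (convRight k H),
    show convRight k H * convAntipode (convRight k H) = 1 from algHom_mul_convAntipode _, one_mul]
  exact algHom_mul_convAntipode _

/-- `Δ(S a) = S a₂ ⊗ S a₁`. -/
theorem comul_antipode {ι : Type*} {a : H} (r : Repr k a ι) :
    comul (R := k) (antipode k a) =
      ∑ i ∈ r.index, antipode k (r.right i) ⊗ₜ[k] antipode k (r.left i) := by
  have h := congr(($(convAntipode_comul k H)).ofConv a)
  change comul (R := k) (antipode k a) = (convAntipode (convRight k H) *
    convAntipode (convLeft k H)) a at h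
  rw [h, r.convMul_apply]
  simp [convAntipode, convLeft, convRight]

/-- `Δ(a₁) (1 ⊗ S a₂) = a ⊗ 1`. -/
theorem sum_comul_mul_one_tmul {ι : Type*} {a : H} (r : Repr k a ι) :
    ∑ i ∈ r.index, comul (R := k) (r.left i) * (1 ⊗ₜ[k] antipode k (r.right i)) = a ⊗ₜ[k] 1 := by
  have h : toConv (Bialgebra.comulAlgHom k H).toLinearMap * convAntipode (convRight k H) =
      convLeft k H := by
    rw [← convLeft_mul_convRight, mul_assoc,
      show convRight k H * convAntipode (convRight k H) = 1 from algHom_mul_convAntipode _, mul_one]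
  have h := congr(($h).ofConv a)
  change (_ * _ : WithConv (H →ₗ[k] H ⊗[k] H)) a = a ⊗ₜ[k] 1 at h
  rw [← h, r.convMul_apply]
  rfl

/-- `(S a₁ ⊗ 1) Δ(a₂) = 1 ⊗ a`. -/
theorem sum_tmul_one_mul_comul {ι : Type*} {a : H} (r : Repr k a ι) :
    ∑ i ∈ r.index, (antipode k (r.left i) ⊗ₜ[k] 1) * comul (R := k) (r.right i) = 1 ⊗ₜ[k] a := by
  have h : convAntipode (convLeft k H) * toConv (Bialgebra.comulAlgHom k H).toLinearMap =
      convRight k H := by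
    rw [← convLeft_mul_convRight, ← mul_assoc,
      show convAntipode (convLeft k H) * convLeft k H = 1 from convAntipode_algHom_mul _, one_mul]
  have h := congr(($h).ofConv a)
  change (_ * _ : WithConv (H →ₗ[k] H ⊗[k] H)) a = 1 ⊗ₜ[k] a at h
  rw [← h, r.convMul_apply]
  rfl

/-- `(1 ⊗ a₁) Δ(S a₂) = S a ⊗ 1`. -/
theorem sum_one_tmul_mul_comul_antipode {ι : Type*} {a : H} (r : Repr k a ι) :
    ∑ i ∈ r.index, (1 ⊗ₜ[k] r.left i) * comul (R := k) (antipode k (r.right i)) =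
      antipode k a ⊗ₜ[k] 1 := by
  have h : convRight k H * convAntipode (toConv (Bialgebra.comulAlgHom k H).toLinearMap) =
      convAntipode (convLeft k H) := by
    rw [convAntipode_comul, ← mul_assoc,
      show convRight k H * convAntipode (convRight k H) = 1 from algHom_mul_convAntipode _, one_mul]
  have h := congr(($h).ofConv a)
  change (_ * _ : WithConv (H →ₗ[k] H ⊗[k] H)) a = antipode k a ⊗ₜ[k] 1 at h
  rw [← h, r.convMul_apply]
  rfl

/-- `Δ(S a₁) (a₂ ⊗ 1) = 1 ⊗ S a`. -/
theorem sum_comul_antipode_mul_tmul_one {ι : Type*} {a : H} (r : Repr k a ι) :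
    ∑ i ∈ r.index, comul (R := k) (antipode k (r.left i)) * (r.right i ⊗ₜ[k] 1) =
      1 ⊗ₜ[k] antipode k a := by
  have h : convAntipode (toConv (Bialgebra.comulAlgHom k H).toLinearMap) * convLeft k H =
      convAntipode (convRight k H) := by
    rw [convAntipode_comul, mul_assoc,
      show convAntipode (convLeft k H) * convLeft k H = 1 from convAntipode_algHom_mul _, mul_one]
  have h := congr(($h).ofConv a)
  change (_ * _ : WithConv (H →ₗ[k] H ⊗[k] H)) a = 1 ⊗ₜ[k] antipode k a at h
  rw [← h, r.convMul_apply]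
  rfl

end Convolution

end SemisimpleHopf

namespace SemisimpleHopf

/-! ### Contracting one leg of a tensor with a functional -/

section Slices

variable {k : Type u} [Field k] {H : Type v} [Ring H] [Algebra k H]

/-- `f ⊗ id : H ⊗ H → H`. -/
noncomputable def sliceLeft (f : H →ₗ[k] k) : H ⊗[k] H →ₗ[k] H :=
  (TensorProduct.lid k H).toLinearMap ∘ₗ f.rTensor H

/-- `id ⊗ f : H ⊗ H → H`. -/
noncomputable def sliceRight (f : H →ₗ[k] k) : H ⊗[k] H →ₗ[k] H :=
  (TensorProduct.rid k H).toLinearMap ∘ₗ f.lTensor H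

@[simp]
theorem sliceLeft_tmul (f : H →ₗ[k] k) (a b : H) : sliceLeft f (a ⊗ₜ[k] b) = f a • b := by
  simp [sliceLeft]

@[simp]
theorem sliceRight_tmul (f : H →ₗ[k] k) (a b : H) : sliceRight f (a ⊗ₜ[k] b) = f b • a := by
  simp [sliceRight]

theorem sliceLeft_mul_one_tmul (f : H →ₗ[k] k) (t : H ⊗[k] H) (y : H) :
    sliceLeft f (t * (1 ⊗ₜ y)) = sliceLeft f t * y := by
  induction t with
  | zero => simp
  | tmul a b => simp
  | add s t hs ht => simp [add_mul, hs, ht]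

theorem sliceLeft_one_tmul_mul (f : H →ₗ[k] k) (t : H ⊗[k] H) (y : H) :
    sliceLeft f ((1 ⊗ₜ y) * t) = y * sliceLeft f t := by
  induction t with
  | zero => simp
  | tmul a b => simp
  | add s t hs ht => simp [mul_add, hs, ht]

theorem sliceLeft_mul_tmul_one (f : H →ₗ[k] k) (t : H ⊗[k] H) (y : H) :
    sliceLeft f (t * (y ⊗ₜ 1)) = sliceLeft (f ∘ₗ LinearMap.mulRight k y) t := by
  induction t with
  | zero => simp
  | tmul a b => simp
  | add s t hs ht => simp [add_mul, hs, ht]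

theorem sliceLeft_tmul_one_mul (f : H →ₗ[k] k) (t : H ⊗[k] H) (y : H) :
    sliceLeft f ((y ⊗ₜ 1) * t) = sliceLeft (f ∘ₗ LinearMap.mulLeft k y) t := by
  induction t with
  | zero => simp
  | tmul a b => simp
  | add s t hs ht => simp [mul_add, hs, ht]

theorem sliceRight_tmul_one_mul (f : H →ₗ[k] k) (t : H ⊗[k] H) (y : H) :
    sliceRight f ((y ⊗ₜ 1) * t) = y * sliceRight f t := by
  induction t with
  | zero => simp
  | tmul a b => simp
  | add s t hs ht => simp [mul_add, hs, ht]

theorem sliceRight_mul_tmul_one (f : H →ₗ[k] k) (t : H ⊗[k] H) (y : H) :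
    sliceRight f (t * (y ⊗ₜ 1)) = sliceRight f t * y := by
  induction t with
  | zero => simp
  | tmul a b => simp
  | add s t hs ht => simp [add_mul, hs, ht]

theorem sliceRight_mul_one_tmul (f : H →ₗ[k] k) (t : H ⊗[k] H) (y : H) :
    sliceRight f (t * (1 ⊗ₜ y)) = sliceRight (f ∘ₗ LinearMap.mulRight k y) t := by
  induction t with
  | zero => simp
  | tmul a b => simp
  | add s t hs ht => simp [add_mul, hs, ht]

theorem sliceRight_one_tmul_mul (f : H →ₗ[k] k) (t : H ⊗[k] H) (y : H) :
    sliceRight f ((1 ⊗ₜ y) * t) = sliceRight (f ∘ₗ LinearMap.mulLeft k y) t := by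
  induction t with
  | zero => simp
  | tmul a b => simp
  | add s t hs ht => simp [mul_add, hs, ht]

theorem apply_sliceLeft (f g : H →ₗ[k] k) (t : H ⊗[k] H) :
    g (sliceLeft f t) = f (sliceRight g t) := by
  induction t with
  | zero => simp
  | tmul a b => simp [mul_comm]
  | add s t hs ht => simp [hs, ht]

/-- The functionals `id ⊗ f` separate the points of `H ⊗ H`. -/
theorem eq_of_sliceRight_eq {s t : H ⊗[k] H} (h : ∀ f, sliceRight f s = sliceRight f t) :
    s = t := by
  let b := Module.Free.chooseBasis k H
  apply ((Module.Free.chooseBasis k H).tensorProduct b).repr.injective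
  ext ⟨i, j⟩
  have key : ∀ t : H ⊗[k] H, (((Module.Free.chooseBasis k H).tensorProduct b).repr t) (i, j) =
      (Module.Free.chooseBasis k H).repr (sliceRight (b.coord j) t) i := by
    intro t
    induction t with
    | zero => simp
    | tmul a b => simp
    | add s t hs ht => simp [hs, ht]
  rw [key, key, h]

theorem eq_of_sliceLeft_eq {s t : H ⊗[k] H} (h : ∀ f, sliceLeft f s = sliceLeft f t) : s = t := by
  apply (TensorProduct.comm k H H).injective
  refine eq_of_sliceRight_eq fun f => ?_
  have key : ∀ t : H ⊗[k] H, sliceRight f (TensorProduct.comm k H H t) = sliceLeft f t := by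
    intro t
    induction t with
    | zero => simp
    | tmul a b => simp
    | add s t hs ht => simp [hs, ht]
  rw [key, key, h]

theorem eq_of_forall_dual {V : Type*} [AddCommGroup V] [Module k V] {a b : V}
    (h : ∀ f : V →ₗ[k] k, f a = f b) : a = b := by
  rw [← sub_eq_zero, ← Module.forall_dual_apply_eq_zero_iff k]
  intro f
  rw [map_sub, h, sub_self]

/-- A tensor is a finite sum, so its left legs span a finite-dimensional space. Applied to the
Casimir tensor of H, this yields the finite dimension of H. -/
theorem finiteDimensional_range_sliceRight (t : H ⊗[k] H) :
    FiniteDimensional k (Submodule.span k (Set.range fun f => sliceRight f t)) := by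
  obtain ⟨s, rfl⟩ := TensorProduct.exists_finset (R := k) t
  classical
  have hf : FiniteDimensional k (Submodule.span k ((s.image Prod.fst : Finset H) : Set H)) :=
    FiniteDimensional.span_finset k _
  refine Submodule.finiteDimensional_of_le
    (S₂ := Submodule.span k ((s.image Prod.fst : Finset H) : Set H)) ?_
  rw [Submodule.span_le]
  rintro _ ⟨f, rfl⟩
  simp only [map_sum, sliceRight_tmul]
  exact Submodule.sum_mem _ fun i hi => Submodule.smul_mem _ _
    (Submodule.subset_span (by exact_mod_cast Finset.mem_image_of_mem _ hi))

end Slices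

/-! ### Normalized integrals, finite dimension, bijectivity of the antipode -/

section Hopf

open WithConv Coalgebra HopfAlgebra

variable {k : Type u} [Field k] {H : Type v} [Ring H] [HopfAlgebra k H]

theorem sliceLeft_counit_comul (a : H) :
    sliceLeft (counit (R := k)) (comul (R := k) a) = a := by
  simp [sliceLeft]

theorem sliceRight_counit_comul (a : H) :
    sliceRight (counit (R := k)) (comul (R := k) a) = a := by
  simp [sliceRight]

theorem sliceLeft_comul {ι : Type*} {a : H} (r : Repr k a ι) (f : H →ₗ[k] k) :
    sliceLeft f (comul (R := k) a) = ∑ i ∈ r.index, f (r.left i) • r.right i := by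
  rw [← r.eq]; simp

theorem sliceRight_comul {ι : Type*} {a : H} (r : Repr k a ι) (f : H →ₗ[k] k) :
    sliceRight f (comul (R := k) a) = ∑ i ∈ r.index, f (r.right i) • r.left i := by
  rw [← r.eq]; simp

theorem dual_mul_apply (p q : DualAlgebra k H) (a : H) :
    (p * q).ofConv a = q.ofConv (sliceLeft p.ofConv (comul (R := k) a)) := by
  change (p * q) a = _
  rw [(ℛ k a).convMul_apply, sliceLeft_comul (ℛ k a)]
  simp

theorem dual_mul_apply' (p q : DualAlgebra k H) (a : H) :
    (p * q).ofConv a = p.ofConv (sliceRight q.ofConv (comul (R := k) a)) := by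
  rw [dual_mul_apply, apply_sliceLeft]

theorem dual_one_apply (a : H) : (1 : DualAlgebra k H).ofConv a = counit (R := k) a := rfl

/-- By semisimplicity ker ε = Ae with e idempotent, and x = xe on ker ε. Hence (a - ε(a))(1 - e) =
0, and l = 1 - e works. -/
theorem exists_augmentation_idempotent {A : Type*} [Ring A] [Algebra k A] [IsSemisimpleRing A]
    (ε : A →ₐ[k] k) : ∃ l : A, (∀ a, a * l = ε a • l) ∧ ε l = 1 := by
  obtain ⟨e, he, hJ⟩ := IsSemisimpleRing.ideal_eq_span_idempotent (RingHom.ker ε)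
  have hx : ∀ x ∈ RingHom.ker ε, x * e = x := by
    intro x hx
    rw [hJ, Ideal.mem_span_singleton'] at hx
    obtain ⟨y, rfl⟩ := hx
    rw [mul_assoc, he.eq]
  have hee : ε e = 0 := by
    have : e ∈ RingHom.ker ε := hJ ▸ Ideal.mem_span_singleton_self e
    exact this
  refine ⟨1 - e, fun a => ?_, by simp [hee]⟩
  have := hx (a - algebraMap k A (ε a)) (by simp [RingHom.mem_ker])
  rw [sub_mul, ← Algebra.smul_def] at this
  rw [mul_sub, mul_one, smul_sub, ← Algebra.algebraMap_eq_smul_one, sub_eq_sub_iff_add_eq_add]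
  rw [sub_eq_iff_eq_add] at this
  rw [this]
  abel

variable (k) in
/-- `l` is a two-sided integral of `H` with `ε(l) = 1`. -/
structure IsNormalizedIntegral (l : H) : Prop where
  mul_left : ∀ h, h * l = counit (R := k) h • l
  mul_right : ∀ h, l * h = counit (R := k) h • l
  counit_eq : counit (R := k) l = 1

variable (k H) in
-- A left integral l comes from H and a right integral m from the opposite algebra; computing ml in
-- both ways gives l = m.
theorem exists_isNormalizedIntegral [IsSemisimpleRing H] : ∃ l : H, IsNormalizedIntegral k l := by
  obtain ⟨l, hl, hl1⟩ := exists_augmentation_idempotent (Bialgebra.counitAlgHom k H)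
  obtain ⟨m, hm, hm1⟩ := exists_augmentation_idempotent (A := Hᵐᵒᵖ)
    ((Bialgebra.counitAlgHom k H).fromOpposite fun _ _ => Commute.all _ _)
  have hm' : ∀ h, m.unop * h = counit (R := k) h • m.unop := fun h =>
    MulOpposite.op_injective (hm (MulOpposite.op h))
  have : l = m.unop := by
    have h1 := hl m.unop
    have h2 := hm' l
    rw [h2] at h1
    have h3 : (Bialgebra.counitAlgHom k H) m.unop = 1 := hm1
    have h4 : counit (R := k) l = 1 := hl1
    rw [h3, h4, one_smul, one_smul] at h1
    exact h1.symm
  exact ⟨l, hl, this ▸ hm', hl1⟩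

variable {l : H}

/-- Since aΛ = ε(a)Λ, the tensor C = Λ₁ ⊗ S(Λ₂) satisfies (a₁ ⊗ 1) C (1 ⊗ S(a₂)) = ε(a) C;
convolving with a ↦ 1 ⊗ a cancels the antipode. -/
theorem IsNormalizedIntegral.casimir (hl : IsNormalizedIntegral k l) (h : H) :
    (h ⊗ₜ[k] 1) * (antipode k).lTensor H (comul (R := k) l) =
      (antipode k).lTensor H (comul (R := k) l) * (1 ⊗ₜ[k] h) := by
  set C := (antipode k).lTensor H (comul (R := k) l) with hC
  let g : WithConv (H →ₗ[k] H ⊗[k] H) := toConv (LinearMap.mulRight k C ∘ₗ (convLeft k H).ofConv)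
  let f : WithConv (H →ₗ[k] H ⊗[k] H) :=
    toConv ((antipode k).lTensor H ∘ₗ comul (R := k) ∘ₗ LinearMap.mulRight k l)
  have hS : ∀ (x y : H) (t : H ⊗[k] H), (antipode k).lTensor H ((x ⊗ₜ[k] y) * t) =
      (x ⊗ₜ[k] 1) * (antipode k).lTensor H t * (1 ⊗ₜ[k] antipode k y) := by
    intro x y t
    induction t with
    | zero => simp
    | tmul a b => simp [antipode_mul_antidistrib]
    | add s t hs ht => simp [mul_add, add_mul, hs, ht]
  have hf : f = g * convAntipode (convRight k H) := by
    ext a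
    rw [(ℛ k a).convMul_apply]
    change (antipode k).lTensor H (comul (R := k) (a * l)) = _
    rw [Bialgebra.comul_mul, ← (ℛ k a).eq, Finset.sum_mul, map_sum]
    refine Finset.sum_congr rfl fun i _ => ?_
    rw [hS]
    rfl
  have h1 : f * convRight k H = g := by
    rw [hf, mul_assoc, show convAntipode (convRight k H) * convRight k H = 1 from
      convAntipode_algHom_mul _, mul_one]
  have h2 := congr(($h1).ofConv h)
  change (f * convRight k H) h = (h ⊗ₜ[k] 1) * C at h2
  rw [← h2, (ℛ k h).convMul_apply]
  have h3 : ∀ a, f a = counit (R := k) a • C := by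
    intro a
    change (antipode k).lTensor H (comul (R := k) (a * l)) = _
    rw [hl.mul_left, map_smul, map_smul]
  conv_rhs => rw [← sum_counit_smul (ℛ k h), TensorProduct.tmul_sum, Finset.mul_sum]
  refine Finset.sum_congr rfl fun i _ => ?_
  rw [h3, TensorProduct.tmul_smul, mul_smul_comm, smul_mul_assoc]
  rfl

theorem IsNormalizedIntegral.mul_lTensor_antipode (hl : IsNormalizedIntegral k l) :
    LinearMap.mul' k H ((antipode k).lTensor H (comul (R := k) l)) = 1 := by
  rw [mul_antipode_lTensor_comul_apply, hl.counit_eq, map_one]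

/-- By the Casimir identity the left legs of C span a finite-dimensional left ideal. H acts
faithfully on it: if h kills it then (h ⊗ 1)C = 0, and multiplying the legs together gives h = 0, as
Λ₁S(Λ₂) = 1. -/
theorem IsNormalizedIntegral.finiteDimensional (hl : IsNormalizedIntegral k l) :
    FiniteDimensional k H := by
  set C := (antipode k).lTensor H (comul (R := k) l) with hC
  let L := Submodule.span k (Set.range fun f => sliceRight f C)
  have hLf : FiniteDimensional k L := finiteDimensional_range_sliceRight C
  have hL : ∀ h : H, ∀ x ∈ L, h * x ∈ L := by
    intro h x hx
    have : L ≤ L.comap (LinearMap.mulLeft k h) := by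
      refine Submodule.span_le.2 ?_
      rintro _ ⟨f, rfl⟩
      refine Submodule.subset_span ⟨f ∘ₗ LinearMap.mulRight k h, ?_⟩
      simp only [LinearMap.mulLeft_apply]
      rw [← sliceRight_tmul_one_mul, hl.casimir h, sliceRight_mul_one_tmul]
    exact this hx
  let ρ : H →ₗ[k] Module.End k L :=
    { toFun := fun h => (LinearMap.mulLeft k h).restrict (hL h)
      map_add' := fun a b => by ext x; exact add_mul a b (x : H)
      map_smul' := fun c b => by ext x; exact smul_mul_assoc c b (x : H) }
  refine Module.Finite.of_injective ρ ?_
  refine (injective_iff_map_eq_zero ρ).2 fun h hh => ?_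
  have h1 : (h ⊗ₜ[k] 1) * C = 0 := by
    refine eq_of_sliceRight_eq fun f => ?_
    rw [sliceRight_tmul_one_mul, map_zero]
    have := congr((($hh) ⟨sliceRight f C, Submodule.subset_span ⟨f, rfl⟩⟩ : H))
    exact this
  have h2 : ∀ t : H ⊗[k] H, LinearMap.mul' k H ((h ⊗ₜ[k] 1) * t) = h * LinearMap.mul' k H t := by
    intro t
    induction t with
    | zero => simp
    | tmul a b => simp [mul_assoc]
    | add s t hs ht => simp [mul_add, hs, ht]
  have h3 := h2 C
  rw [h1, hl.mul_lTensor_antipode, map_zero, mul_one] at h3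
  exact h3.symm

/-- `Λ₁ a ⊗ Λ₂ = Λ₁ ⊗ Λ₂ S(a)`. -/
theorem IsNormalizedIntegral.comul_mul_tmul_one (hl : IsNormalizedIntegral k l) (a : H) :
    comul (R := k) l * (a ⊗ₜ[k] 1) = comul (R := k) l * (1 ⊗ₜ[k] antipode k a) := by
  rw [← sum_comul_mul_one_tmul (ℛ k a), Finset.mul_sum]
  conv_rhs => rw [← sum_counit_smul (ℛ k a), map_sum, TensorProduct.tmul_sum, Finset.mul_sum]
  refine Finset.sum_congr rfl fun i _ => ?_
  rw [← mul_assoc, ← Bialgebra.comul_mul, hl.mul_right]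
  simp

/-- `Λ₁ ⊗ a Λ₂ = S(a) Λ₁ ⊗ Λ₂`. -/
theorem IsNormalizedIntegral.one_tmul_mul_comul (hl : IsNormalizedIntegral k l) (a : H) :
    (1 ⊗ₜ[k] a) * comul (R := k) l = (antipode k a ⊗ₜ[k] 1) * comul (R := k) l := by
  have hsum : ∑ i ∈ (ℛ k a).index, counit (R := k) ((ℛ k a).right i) • (ℛ k a).left i = a := by
    rw [← sliceRight_comul, sliceRight_counit_comul]
  rw [← sum_tmul_one_mul_comul (ℛ k a), Finset.sum_mul]
  conv_rhs => rw [← hsum, map_sum, TensorProduct.sum_tmul, Finset.sum_mul]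
  refine Finset.sum_congr rfl fun i _ => ?_
  rw [mul_assoc, ← Bialgebra.comul_mul, hl.mul_left, map_smul, map_smul, mul_smul_comm,
    ← TensorProduct.smul_tmul', smul_mul_assoc]

/-- The kernel of S is a two-sided ideal, generated by a central idempotent e. Then Λ₁e ⊗ Λ₂ = Λ₁ ⊗
Λ₂S(e) = 0, and applying x ⊗ y ↦ xS(y) gives e = 0. -/
theorem IsNormalizedIntegral.antipode_injective [IsSemisimpleRing H]
    (hl : IsNormalizedIntegral k l) : Function.Injective (antipode k (A := H)) := by
  rw [← LinearMap.ker_eq_bot, LinearMap.ker_eq_bot']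
  let J : Ideal H :=
    { carrier := {x | antipode k x = 0}
      zero_mem' := by simp
      add_mem' := fun {a b} ha hb => by
        simp only [Set.mem_ofPred_eq] at *
        simp [ha, hb]
      smul_mem' := fun c x hx => by
        simp only [Set.mem_ofPred_eq] at *
        simp [antipode_mul_antidistrib, hx] }
  let J' : Ideal Hᵐᵒᵖ :=
    { carrier := {x | antipode k x.unop = 0}
      zero_mem' := by simp
      add_mem' := fun {a b} ha hb => by
        simp only [Set.mem_ofPred_eq] at *
        simp [ha, hb]
      smul_mem' := fun c x hx => by
        simp only [Set.mem_ofPred_eq] at *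
        simp [antipode_mul_antidistrib, hx] }
  obtain ⟨e, he, hJ⟩ := IsSemisimpleRing.ideal_eq_span_idempotent J
  obtain ⟨f, hf, hJ'⟩ := IsSemisimpleRing.ideal_eq_span_idempotent J'
  have heJ : antipode k e = 0 := by
    have : e ∈ J := hJ ▸ Ideal.mem_span_singleton_self e
    exact this
  have hfJ : antipode k f.unop = 0 := by
    have : f ∈ J' := hJ' ▸ Ideal.mem_span_singleton_self f
    exact this
  have hxe : ∀ x, antipode k x = 0 → x * e = x := by
    intro x hx
    have hx : x ∈ J := hx
    rw [hJ, Ideal.mem_span_singleton'] at hx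
    obtain ⟨y, rfl⟩ := hx
    rw [mul_assoc, he.eq]
  have hxf : ∀ x, antipode k x = 0 → f.unop * x = x := by
    intro x hx
    have hx : MulOpposite.op x ∈ J' := hx
    rw [hJ', Ideal.mem_span_singleton'] at hx
    obtain ⟨y, hy⟩ := hx
    have : x = f.unop * y.unop := congr(MulOpposite.unop $hy.symm)
    rw [this, ← mul_assoc, ← MulOpposite.unop_mul, hf.eq]
  have hef : f.unop = e := by rw [← hxe _ hfJ, hxf _ heJ]
  have hcomm : ∀ h, h * e = e * h := by
    intro h
    have h1 := hxf (h * e) (by simp [antipode_mul_antidistrib, heJ])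
    have h2 := hxe (e * h) (by simp [antipode_mul_antidistrib, heJ])
    rw [hef] at h1
    rw [← h1, ← mul_assoc, h2]
  have h1 := hl.comul_mul_tmul_one e
  rw [heJ, TensorProduct.tmul_zero, mul_zero] at h1
  have h2 : ∀ t : H ⊗[k] H, LinearMap.mul' k H ((antipode k).lTensor H (t * (e ⊗ₜ[k] 1))) =
      e * LinearMap.mul' k H ((antipode k).lTensor H t) := by
    intro t
    induction t with
    | zero => simp
    | tmul a b => simp [hcomm, mul_assoc]
    | add s t hs ht => simp [add_mul, mul_add, hs, ht]
  have h3 := h2 (comul (R := k) l)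
  rw [h1, hl.mul_lTensor_antipode, map_zero, map_zero, mul_one] at h3
  intro x hx
  rw [← hxe x hx, ← h3, mul_zero]

theorem IsNormalizedIntegral.antipode_surjective [IsSemisimpleRing H]
    (hl : IsNormalizedIntegral k l) : Function.Surjective (antipode k (A := H)) :=
  have := hl.finiteDimensional
  LinearMap.injective_iff_surjective.1 hl.antipode_injective

theorem IsNormalizedIntegral.antipode_eq [IsSemisimpleRing H]
    (hl : IsNormalizedIntegral k l) : antipode k l = l := by
  have h1 : ∀ h, h * antipode k l = counit (R := k) h • antipode k l := by
    intro h
    obtain ⟨a, rfl⟩ := hl.antipode_surjective h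
    rw [← antipode_mul_antidistrib, hl.mul_right]
    simp
  have h2 := h1 l
  rwa [hl.mul_right, counit_antipode, hl.counit_eq, one_smul, one_smul, eq_comm] at h2

end Hopf

end SemisimpleHopf

namespace SemisimpleHopf

/-! ### The trace functional as an integral of the dual -/

section Frobenius

open WithConv Coalgebra HopfAlgebra

variable {k : Type u} [Field k] {H : Type v} [Ring H] [HopfAlgebra k H]

/-- `∑ S(α ⇁ a₁) a₂ = ∑ ⟨α, a₁⟩ S(a₂) a₃ = ⟨α, a⟩ 1`. -/
theorem sum_antipode_sliceLeft_mul {ι : Type*} {a : H} (r : Repr k a ι) (α : H →ₗ[k] k) :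
    ∑ i ∈ r.index, antipode k (sliceLeft α (comul (R := k) (r.left i))) * r.right i = α a • 1 := by
  let A : WithConv (H →ₗ[k] H) := toConv (Algebra.linearMap k H ∘ₗ α)
  have hA : A * toConv (antipode k) =
      toConv (antipode k ∘ₗ sliceLeft α ∘ₗ comul (R := k)) := by
    ext x
    rw [(ℛ k x).convMul_apply]
    change _ = antipode k (sliceLeft α (comul (R := k) x))
    rw [sliceLeft_comul (ℛ k x), map_sum]
    exact Finset.sum_congr rfl fun i _ => by rw [map_smul, Algebra.smul_def]; rfl
  have h : toConv (antipode k ∘ₗ sliceLeft α ∘ₗ comul (R := k)) * toConv LinearMap.id = A := by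
    rw [← hA, mul_assoc, LinearMap.antipode_mul_id, mul_one]
  have h := congr(($h).ofConv a)
  change (_ * _ : WithConv (H →ₗ[k] H)) a = algebraMap k H (α a) at h
  rw [← Algebra.algebraMap_eq_smul_one, ← h, r.convMul_apply]
  rfl

variable (k H) in
/-- The functional `h ↦ tr (x ↦ S²(x) h)`. -/
noncomputable def antipodeTrace : H →ₗ[k] k :=
  LinearMap.trace k H ∘ₗ LinearMap.lcomp k H (antipode k ∘ₗ antipode k) ∘ₗ
    (LinearMap.mul k H).flip

theorem antipodeTrace_apply (h : H) :
    antipodeTrace k H h = LinearMap.trace k H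
      (LinearMap.mulRight k h ∘ₗ antipode k ∘ₗ antipode k) := rfl

/-- `u ⊗ v ↦ (id ⊗ q)((1 ⊗ S v) Δ(u))`. -/
noncomputable def antipodeSlice (q : H →ₗ[k] k) : H ⊗[k] H →ₗ[k] H :=
  TensorProduct.lift (LinearMap.mk₂ k
    (fun u v => sliceRight q ((1 ⊗ₜ[k] antipode k v) * comul (R := k) u))
    (fun _ _ _ => by simp [mul_add]) (fun _ _ _ => by simp)
    (fun _ _ _ => by simp [TensorProduct.tmul_add, add_mul]) (fun _ _ _ => by simp))

theorem antipodeSlice_tmul (q : H →ₗ[k] k) (u v : H) : antipodeSlice q (u ⊗ₜ v) =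
    sliceRight q ((1 ⊗ₜ[k] antipode k v) * comul (R := k) u) := rfl

/-- This is the rank-one case of `trace_antipodeSlice`. For f = α(·)a the operator is x ↦ α(x₁)
q(S(x₂)a₂) a₁, so its trace is q(S(α(a₁)a₂)a₃) = q(1)α(a). -/
theorem trace_antipodeSlice_smulRight [FiniteDimensional k H] (q α : H →ₗ[k] k) (a : H) :
    LinearMap.trace k H (antipodeSlice q ∘ₗ (α.smulRight a).rTensor H ∘ₗ comul (R := k)) =
      q 1 * α a := by
  have h1 : antipodeSlice q ∘ₗ (α.smulRight a).rTensor H ∘ₗ comul (R := k) =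
      ∑ i ∈ (ℛ k a).index, (q ∘ₗ LinearMap.mulRight k ((ℛ k a).right i) ∘ₗ antipode k ∘ₗ
        sliceLeft α ∘ₗ comul (R := k)).smulRight ((ℛ k a).left i) := by
    ext x
    simp only [LinearMap.comp_apply, LinearMap.sum_apply, LinearMap.smulRight_apply,
      LinearMap.mulRight_apply]
    rw [sliceLeft_comul (ℛ k x), ← (ℛ k x).eq]
    simp only [map_sum, LinearMap.rTensor_tmul, LinearMap.smulRight_apply, antipodeSlice_tmul,
      map_smul, Finset.sum_mul, Finset.sum_smul]
    rw [← (ℛ k a).eq]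
    simp only [Finset.mul_sum, Finset.smul_sum, map_sum, Algebra.TensorProduct.tmul_mul_tmul,
      one_mul, sliceRight_tmul, smul_mul_assoc, mul_smul_comm, map_smul, smul_assoc]
    rw [Finset.sum_comm]
  rw [h1, map_sum]
  simp only [LinearMap.trace_smulRight, LinearMap.comp_apply, LinearMap.mulRight_apply]
  rw [← map_sum, sum_antipode_sliceLeft_mul, map_smul, smul_eq_mul, mul_comm]

theorem linearMap_eq_sum_smulRight {ι : Type*} [Fintype ι] {V : Type*} [AddCommGroup V]
    [Module k V] (b : Module.Basis ι k V) (f : V →ₗ[k] V) :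
    f = ∑ i, (b.coord i).smulRight (f (b i)) := by
  ext x
  simp only [LinearMap.sum_apply, LinearMap.smulRight_apply, Module.Basis.coord_apply]
  conv_lhs => rw [← b.sum_repr x, map_sum]
  simp

theorem trace_antipodeSlice [FiniteDimensional k H] (q : H →ₗ[k] k) (f : H →ₗ[k] H) :
    LinearMap.trace k H (antipodeSlice q ∘ₗ f.rTensor H ∘ₗ comul (R := k)) =
      q 1 * LinearMap.trace k H f := by
  let b := Module.finBasis k H
  have h1 : antipodeSlice q ∘ₗ f.rTensor H ∘ₗ comul (R := k) = ∑ i, antipodeSlice q ∘ₗ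
      ((b.coord i).smulRight (f (b i))).rTensor H ∘ₗ comul (R := k) := by
    conv_lhs => rw [linearMap_eq_sum_smulRight b f]
    ext x
    simp only [LinearMap.comp_apply, LinearMap.sum_apply, ← LinearMap.coe_rTensorHom, map_sum]
  rw [h1, map_sum]
  simp only [trace_antipodeSlice_smulRight]
  conv_rhs => rw [linearMap_eq_sum_smulRight b f, map_sum, Finset.mul_sum]
  simp only [LinearMap.trace_smulRight]

/-- `λ(h₁) h₂ = λ(h) 1`, as an identity in the dual algebra. -/
theorem antipodeTrace_mul [FiniteDimensional k H] (q : DualAlgebra k H) :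
    toConv (antipodeTrace k H) * q = q.ofConv 1 • toConv (antipodeTrace k H) := by
  ext h
  change (toConv (antipodeTrace k H) * q).ofConv h = q.ofConv 1 * antipodeTrace k H h
  rw [dual_mul_apply', antipodeTrace_apply h, ← trace_antipodeSlice]
  change antipodeTrace k H _ = _
  rw [antipodeTrace_apply]
  congr 1
  ext x
  simp only [LinearMap.comp_apply, LinearMap.mulRight_apply]
  rw [← sliceRight_tmul_one_mul]
  -- It remains to see (S²(x) ⊗ 1)Δ(h) = (1 ⊗ S(x₂))Δ(S²(x₁))Δ(h), which is
  -- `sum_one_tmul_mul_comul_antipode` for S(x), whose coproduct is S(x₂) ⊗ S(x₁).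
  let r' : Repr k (antipode k x) (H × H) :=
    { index := (ℛ k x).index
      left := fun i => antipode k ((ℛ k x).right i)
      right := fun i => antipode k ((ℛ k x).left i)
      eq := (comul_antipode (ℛ k x)).symm }
  rw [← sum_one_tmul_mul_comul_antipode r', ← (ℛ k x).eq, Finset.sum_mul]
  simp only [map_sum, LinearMap.rTensor_tmul, antipodeSlice_tmul, LinearMap.comp_apply,
    LinearMap.mulRight_apply, Bialgebra.comul_mul, mul_assoc]
  rfl

theorem sliceLeft_antipodeTrace [FiniteDimensional k H] (h : H) :
    sliceLeft (antipodeTrace k H) (comul (R := k) h) = antipodeTrace k H h • 1 := by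
  refine eq_of_forall_dual (k := k) fun q => ?_
  have h1 := congr(($(antipodeTrace_mul (k := k) (H := H) (toConv q))).ofConv h)
  rw [dual_mul_apply] at h1
  rw [map_smul, smul_eq_mul, mul_comm]
  exact h1

variable {l : H}

/-- The operator x ↦ S²(x)Λ = ε(x)Λ has rank one and trace ε(Λ). -/
theorem IsNormalizedIntegral.antipodeTrace_eq [FiniteDimensional k H]
    (hl : IsNormalizedIntegral k l) :
    antipodeTrace k H l = 1 := by
  have : LinearMap.mulRight k l ∘ₗ antipode k ∘ₗ antipode k =
      (counit (R := k) (A := H)).smulRight l := by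
    ext x
    simp [hl.mul_left]
  rw [antipodeTrace_apply, this, LinearMap.trace_smulRight, hl.counit_eq]

end Frobenius

end SemisimpleHopf

namespace SemisimpleHopf

/-! ### The Frobenius form, the modular element and Radford's formula -/

section Frobenius

open WithConv Coalgebra HopfAlgebra

variable {k : Type u} [Field k] {H : Type v} [Ring H] [HopfAlgebra k H] [FiniteDimensional k H]
variable {l : H}

namespace IsNormalizedIntegral

/-- `λ(S(a) Λ₁) Λ₂ = a`. -/
theorem sliceLeft_mulLeft_antipode (hl : IsNormalizedIntegral k l) (a : H) :
    sliceLeft (antipodeTrace k H ∘ₗ LinearMap.mulLeft k (antipode k a)) (comul (R := k) l) = a := by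
  rw [← sliceLeft_tmul_one_mul, ← hl.one_tmul_mul_comul, sliceLeft_one_tmul_mul,
    sliceLeft_antipodeTrace, hl.antipodeTrace_eq, one_smul, mul_one]

/-- `λ(Λ₁ a) Λ₂ = S(a)`. -/
theorem sliceLeft_mulRight (hl : IsNormalizedIntegral k l) (a : H) :
    sliceLeft (antipodeTrace k H ∘ₗ LinearMap.mulRight k a) (comul (R := k) l) = antipode k a := by
  rw [← sliceLeft_mul_tmul_one, hl.comul_mul_tmul_one, sliceLeft_mul_one_tmul,
    sliceLeft_antipodeTrace, hl.antipodeTrace_eq, one_smul, one_mul]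

theorem toConv_antipodeTrace_ne_zero (hl : IsNormalizedIntegral k l) :
    toConv (antipodeTrace k H) ≠ (0 : DualAlgebra k H) := by
  intro h
  have := congr(($h).ofConv l)
  change antipodeTrace k H l = 0 at this
  rw [hl.antipodeTrace_eq] at this
  exact one_ne_zero this

variable [IsSemisimpleRing H]

theorem antipodeTrace_mulLeft_injective (hl : IsNormalizedIntegral k l) {a b : H}
    (h : ∀ y, antipodeTrace k H (a * y) = antipodeTrace k H (b * y)) : a = b := by
  obtain ⟨a, rfl⟩ := hl.antipode_surjective a
  obtain ⟨b, rfl⟩ := hl.antipode_surjective b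
  rw [← hl.sliceLeft_mulLeft_antipode a, ← hl.sliceLeft_mulLeft_antipode b]
  congr 3
  ext y
  exact h y

theorem exists_eq_antipodeTrace_mulLeft (hl : IsNormalizedIntegral k l) (q : H →ₗ[k] k) :
    ∃ c, q = antipodeTrace k H ∘ₗ LinearMap.mulLeft k c := by
  let Φ : H →ₗ[k] H →ₗ[k] k := (LinearMap.mul k H).compr₂ (antipodeTrace k H)
  have hinj : Function.Injective Φ := fun a b hab =>
    hl.antipodeTrace_mulLeft_injective fun y => congr($hab y)
  have hsurj : Function.Surjective Φ :=
    (LinearMap.injective_iff_surjective_of_finrank_eq_finrank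
      (Subspace.dual_finrank_eq (K := k) (V := H)).symm).1 hinj
  obtain ⟨c, hc⟩ := hsurj q
  exact ⟨c, hc ▸ rfl⟩

/-- The map p ↦ p(Λ₁)Λ₂ inverts a ↦ λ(S(a) ·), so equalities of functionals can be checked after
applying it. -/
theorem eq_of_sliceLeft_comul_eq (hl : IsNormalizedIntegral k l) {p q : H →ₗ[k] k}
    (h : sliceLeft p (comul (R := k) l) = sliceLeft q (comul (R := k) l)) : p = q := by
  obtain ⟨c, rfl⟩ := hl.exists_eq_antipodeTrace_mulLeft p
  obtain ⟨d, rfl⟩ := hl.exists_eq_antipodeTrace_mulLeft q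
  obtain ⟨a, rfl⟩ := hl.antipode_surjective c
  obtain ⟨b, rfl⟩ := hl.antipode_surjective d
  rw [hl.sliceLeft_mulLeft_antipode, hl.sliceLeft_mulLeft_antipode] at h
  rw [h]

/-- The Nakayama automorphism of the Frobenius form is `S²`. -/
theorem antipodeTrace_mul_comm (hl : IsNormalizedIntegral k l) (a y : H) :
    antipodeTrace k H (y * a) = antipodeTrace k H (antipode k (antipode k a) * y) := by
  have h : antipodeTrace k H ∘ₗ LinearMap.mulRight k a =
      antipodeTrace k H ∘ₗ LinearMap.mulLeft k (antipode k (antipode k a)) :=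
    hl.eq_of_sliceLeft_comul_eq (by
      rw [hl.sliceLeft_mulRight, hl.sliceLeft_mulLeft_antipode])
  exact congr($h y)

/-- Right integrals in the dual algebra are unique up to scalars. -/
theorem eq_smul_antipodeTrace (hl : IsNormalizedIntegral k l) {p : DualAlgebra k H}
    (hp : ∀ q : DualAlgebra k H, p * q = q.ofConv 1 • p) :
    p = p.ofConv l • toConv (antipodeTrace k H) := by
  have h1 : sliceLeft p.ofConv (comul (R := k) l) = p.ofConv l • (1 : H) := by
    refine eq_of_forall_dual (k := k) fun q => ?_
    have h1 := congr(($(hp (toConv q))).ofConv l)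
    rw [dual_mul_apply] at h1
    rw [map_smul, smul_eq_mul, mul_comm]
    exact h1
  have h2 : p.ofConv = p.ofConv l • antipodeTrace k H := by
    refine hl.eq_of_sliceLeft_comul_eq ?_
    have h3 : sliceLeft (p.ofConv l • antipodeTrace k H) =
        p.ofConv l • sliceLeft (antipodeTrace k H) := by
      refine TensorProduct.ext' fun x y => ?_
      simp [mul_smul]
    rw [h1, h3, LinearMap.smul_apply, sliceLeft_antipodeTrace, hl.antipodeTrace_eq, one_smul]
  exact WithConv.ofConv_injective h2

/-- `λ(S(Λ₂) h) Λ₁ = h`. -/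
theorem sum_antipodeTrace_smul (hl : IsNormalizedIntegral k l) {ι : Type*} (r : Repr k l ι)
    (h : H) : ∑ i ∈ r.index, antipodeTrace k H (antipode k (r.right i) * h) • r.left i = h := by
  refine eq_of_forall_dual (k := k) fun q => ?_
  obtain ⟨c, rfl⟩ := hl.exists_eq_antipodeTrace_mulLeft q
  obtain ⟨a, rfl⟩ := hl.antipode_surjective c
  have h1 := hl.sliceLeft_mulLeft_antipode a
  rw [sliceLeft_comul r] at h1
  simp only [LinearMap.comp_apply, LinearMap.mulLeft_apply, map_sum, map_smul] at h1 ⊢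
  conv_rhs => rw [← h1]
  simp only [map_sum, map_smul, Finset.sum_mul, smul_mul_assoc, smul_eq_mul]
  exact Finset.sum_congr rfl fun i _ => mul_comm _ _

/-- The trace formula `tr T = λ(S(Λ₂) T(Λ₁))`. -/
theorem trace_eq (hl : IsNormalizedIntegral k l) {ι : Type*} (r : Repr k l ι) (T : H →ₗ[k] H) :
    LinearMap.trace k H T =
      ∑ i ∈ r.index, antipodeTrace k H (antipode k (r.right i) * T (r.left i)) := by
  have : T = ∑ i ∈ r.index, (antipodeTrace k H ∘ₗ
      LinearMap.mulLeft k (antipode k (r.right i))).smulRight (T (r.left i)) := by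
    ext x
    conv_lhs => rw [← hl.sum_antipodeTrace_smul r x]
    simp
  conv_lhs => rw [this]
  simp

/-- `tr (x ↦ ⟨p, x₁⟩ S²(x₂)) = ⟨p, Λ⟩ λ(1)`. -/
theorem trace_antipode_antipode_sliceLeft (hl : IsNormalizedIntegral k l) (p : H →ₗ[k] k) :
    LinearMap.trace k H (antipode k ∘ₗ antipode k ∘ₗ sliceLeft p ∘ₗ comul (R := k)) =
      p l * antipodeTrace k H 1 := by
  rw [hl.trace_eq (ℛ k l)]
  simp only [LinearMap.comp_apply, ← antipode_mul_antidistrib]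
  rw [← map_sum, ← map_sum, sum_antipode_sliceLeft_mul]
  simp

theorem trace_antipode_antipode (hl : IsNormalizedIntegral k l) :
    LinearMap.trace k H (antipode k ∘ₗ antipode k) = antipodeTrace k H 1 := by
  have := hl.trace_antipode_antipode_sliceLeft counit
  rw [hl.counit_eq, one_mul] at this
  rw [← this]
  congr 1
  ext x
  simp [sliceLeft_counit_comul]

variable (k l) in
/-- The distinguished element `λ(Λ₂) Λ₁`. -/
noncomputable def _root_.SemisimpleHopf.modularElement : H :=
  sliceRight (antipodeTrace k H) (comul (R := k) l)

/-- The product pλ is again a right integral, hence a multiple of λ; the scalar is its value at Λ,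
which is p(λ(Λ₂)Λ₁). -/
theorem mul_antipodeTrace (hl : IsNormalizedIntegral k l) (p : DualAlgebra k H) :
    p * toConv (antipodeTrace k H) =
      p.ofConv (modularElement k l) • toConv (antipodeTrace k H) := by
  rw [hl.eq_smul_antipodeTrace (p := p * toConv (antipodeTrace k H)) fun q => ?_,
    dual_mul_apply']
  · rfl
  · rw [mul_assoc, antipodeTrace_mul, mul_smul_comm]

theorem isGroupLikeElem_modularElement (hl : IsNormalizedIntegral k l) :
    IsGroupLikeElem k (modularElement k l) where
  counit_eq_one := by
    have h := hl.mul_antipodeTrace 1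
    rw [one_mul, dual_one_apply] at h
    by_contra hne
    refine hl.toConv_antipodeTrace_ne_zero ?_
    have h2 : (counit (R := k) (modularElement k l) - 1) •
        toConv (antipodeTrace k H) = (0 : DualAlgebra k H) := by
      rw [sub_smul, one_smul, ← h, sub_self]
    exact (smul_eq_zero.1 h2).resolve_left (sub_ne_zero.2 hne)
  comul_eq_tmul_self := by
    refine eq_of_sliceRight_eq fun q => eq_of_forall_dual (k := k) fun p => ?_
    have h1 := hl.mul_antipodeTrace (toConv p * toConv q)
    rw [mul_assoc, hl.mul_antipodeTrace, mul_smul_comm, hl.mul_antipodeTrace, smul_smul] at h1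
    have h2 := congr(($h1).ofConv l)
    change _ * antipodeTrace k H l = _ * antipodeTrace k H l at h2
    rw [hl.antipodeTrace_eq, mul_one, mul_one, dual_mul_apply'] at h2
    rw [sliceRight_tmul, map_smul, smul_eq_mul]
    exact h2.symm

/-- `λ(g S(h)) = λ(h)`. -/
theorem antipodeTrace_modularElement_mul_antipode (hl : IsNormalizedIntegral k l) (h : H) :
    antipodeTrace k H (modularElement k l * antipode k h) = antipodeTrace k H h := by
  set g := modularElement k l with hg
  have hgl : IsGroupLikeElem k g := hl.isGroupLikeElem_modularElement
  -- As g is grouplike, G(h) = gS(h) reverses the coproduct: Δ(G(h)) = G(h₂) ⊗ G(h₁). So the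
  -- left-hand rule pλ = p(g)λ, used with p = q ∘ F where F inverts G, shows that λ ∘ G is a right
  -- integral. It is a multiple of λ, and both take the value 1 at Λ.
  let G : H →ₗ[k] H := LinearMap.mulLeft k g ∘ₗ antipode k
  have hG : LinearMap.ker G = ⊥ := by
    refine LinearMap.ker_eq_bot'.2 fun x hx => hl.antipode_injective ?_
    rw [map_zero]
    exact hgl.isUnit.mul_right_eq_zero.1 hx
  obtain ⟨F, hF⟩ := LinearMap.exists_leftInverse_of_injective G hG
  have hF : ∀ x, F (G x) = x := fun x => congr($hF x)
  have key : ∀ q : DualAlgebra k H, toConv (antipodeTrace k H ∘ₗ G) * q =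
      q.ofConv 1 • toConv (antipodeTrace k H ∘ₗ G) := by
    intro q
    ext x
    have h1 := congr(($(hl.mul_antipodeTrace (toConv (q.ofConv ∘ₗ F) : DualAlgebra k H))).ofConv (G x))
    change (_ * _ : DualAlgebra k H).ofConv (G x) = (q.ofConv (F g)) * antipodeTrace k H (G x) at h1
    have h2 : F g = 1 := by
      have := hF 1
      simpa [G] using this
    rw [h2, dual_mul_apply'] at h1
    change (_ * _ : DualAlgebra k H).ofConv x = q.ofConv 1 * antipodeTrace k H (G x)
    rw [← h1, dual_mul_apply']
    simp only [G, LinearMap.comp_apply, LinearMap.mulLeft_apply, Bialgebra.comul_mul,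
      hgl.comul_eq_tmul_self]
    rw [comul_antipode (ℛ k x), Finset.mul_sum, sliceRight_comul (ℛ k x)]
    simp only [map_sum, Algebra.TensorProduct.tmul_mul_tmul, sliceRight_tmul, map_smul]
    rw [Finset.mul_sum, map_sum]
    refine Finset.sum_congr rfl fun i _ => ?_
    have h3 := hF ((ℛ k x).right i)
    simp only [G, LinearMap.comp_apply, LinearMap.mulLeft_apply] at h3
    simp only [h3, smul_eq_mul, mul_smul_comm,
      map_smul, mul_comm]
  have h1 := hl.eq_smul_antipodeTrace key
  have h2 := congr(($h1).ofConv h)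
  change antipodeTrace k H (G h) = antipodeTrace k H (G l) * antipodeTrace k H h at h2
  have h3 : antipodeTrace k H (G l) = 1 := by
    change antipodeTrace k H (g * antipode k l) = 1
    rw [hl.antipode_eq, hl.mul_left, hgl.counit_eq_one, one_smul, hl.antipodeTrace_eq]
  rwa [h3, one_mul] at h2

/-- Radford's formula for `S⁴`, for an algebra with a normalized integral. -/
theorem modularElement_mul (hl : IsNormalizedIntegral k l) (b : H) :
    modularElement k l * b =
      antipode k (antipode k (antipode k (antipode k b))) * modularElement k l := by
  obtain ⟨a, rfl⟩ := hl.antipode_surjective b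
  refine hl.antipodeTrace_mulLeft_injective fun y => ?_
  obtain ⟨y, rfl⟩ := hl.antipode_surjective y
  -- With b = S(a): λ(gS(a)S(y)) = λ(ya) = λ(S²(a)y) = λ(gS(y)S³(a)) = λ(S⁵(a)gS(y)), alternating
  -- the two symmetries of λ.
  rw [mul_assoc, ← antipode_mul_antidistrib, hl.antipodeTrace_modularElement_mul_antipode,
    hl.antipodeTrace_mul_comm, ← hl.antipodeTrace_modularElement_mul_antipode,
    antipode_mul_antidistrib, ← mul_assoc, hl.antipodeTrace_mul_comm, mul_assoc]

/-- Grouplike elements are linearly independent, so there are finitely many, and two powers of g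
coincide. -/
theorem exists_modularElement_pow_eq_one (hl : IsNormalizedIntegral k l) :
    ∃ m, 0 < m ∧ modularElement k l ^ m = 1 := by
  have hg := hl.isGroupLikeElem_modularElement
  have hpow : ∀ n : ℕ, IsGroupLikeElem k (modularElement k l ^ n) := fun n =>
    hg.pow
  have hfin : {a : H | IsGroupLikeElem k a}.Finite := by
    have := (linearIndepOn_isGroupLikeElem (R := k) (A := H))
    exact Set.finite_coe_iff.1 (LinearIndependent.finite this)
  obtain ⟨i, j, hij, h⟩ : ∃ i j : ℕ, i < j ∧ modularElement k l ^ i = modularElement k l ^ j := by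
    have := Set.Finite.exists_lt_map_eq_of_forall_mem (t := {a : H | IsGroupLikeElem k a})
      (f := fun n : ℕ => modularElement k l ^ n) (fun n => hpow n) hfin
    exact this
  refine ⟨j - i, by omega, ?_⟩
  have hu := hg.isUnit.pow i
  rw [← hu.mul_right_inj, mul_one, ← pow_add, h]
  congr 1
  omega

end IsNormalizedIntegral

end Frobenius

end SemisimpleHopf

namespace SemisimpleHopf

/-! ### Traces of automorphisms of finite order -/

section FiniteOrder

variable {k : Type u} [Field k] [IsAlgClosed k] [CharZero k]

theorem exists_eigenbasis_of_pow_eq_one {V : Type*} [AddCommGroup V] [Module k V]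
    [FiniteDimensional k V] {u : Module.End k V} {m : ℕ} (hm : 0 < m) (hu : u ^ m = 1) :
    ∃ (n : ℕ) (b : Module.Basis (Fin n) k V) (r : Fin n → k), ∀ i, u (b i) = r i • b i := by
  have hss : u.IsSemisimple := by
    refine Module.End.isSemisimple_of_squarefree_aeval_eq_zero (p := Polynomial.X ^ m - 1) ?_ ?_
    · have : Polynomial.X ^ m - 1 = (Polynomial.X ^ m - Polynomial.C (1 : k)) := by simp
      rw [this]
      exact (Polynomial.separable_X_pow_sub_C (1 : k) (by exact_mod_cast hm.ne')
        one_ne_zero).squarefree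
    · simp [hu]
  classical
  have hint : DirectSum.IsInternal u.eigenspace := by
    rw [DirectSum.isInternal_submodule_iff_iSupIndep_and_iSup_eq_top]
    exact ⟨u.eigenspaces_iSupIndep, hss.iSup_eigenspace_eq_top⟩
  let b := hint.collectedBasis fun μ => Module.finBasis k (u.eigenspace μ)
  have : Fintype (Σ μ, Fin (Module.finrank k (u.eigenspace μ))) :=
    FiniteDimensional.fintypeBasisIndex b
  let e := Fintype.equivFin (Σ μ, Fin (Module.finrank k (u.eigenspace μ)))
  refine ⟨_, b.reindex e, fun i => (e.symm i).1, fun i => ?_⟩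
  rw [Module.Basis.reindex_apply]
  exact Module.End.mem_eigenspace_iff.1 (hint.collectedBasis_mem _ _)

/-- `x ∈ k` is algebraic over `ℚ` and has nonnegative real image under `φ`. -/
def IsNonnegUnder (φ : algebraicClosure ℚ k →+* ℂ) (t : ℝ) (x : k) : Prop :=
  0 ≤ t ∧ ∃ z : algebraicClosure ℚ k, (z : k) = x ∧ φ z = t

/-- The eigenvalues of u are roots of unity and u^(m-1) = u⁻¹ has the inverse eigenvalues, which
become complex conjugates in ℂ. The product of traces becomes |tr u|². -/
theorem isNonnegUnder_trace_mul_trace (φ : algebraicClosure ℚ k →+* ℂ) {V : Type*}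
    [AddCommGroup V] [Module k V] [FiniteDimensional k V] {u : Module.End k V} {m : ℕ}
    (hm : 0 < m) (hu : u ^ m = 1) :
    ∃ t, IsNonnegUnder φ t
      (LinearMap.trace k V u * LinearMap.trace k V (u ^ (m - 1))) := by
  obtain ⟨n, b, r, hr⟩ := exists_eigenbasis_of_pow_eq_one hm hu
  have hpow : ∀ j i, (u ^ j) (b i) = r i ^ j • b i := by
    intro j i
    induction j with
    | zero => simp
    | succ j ih => rw [pow_succ', Module.End.mul_apply, ih, map_smul, hr, smul_smul, pow_succ]
  have htr : ∀ j, LinearMap.trace k V (u ^ j) = ∑ i, r i ^ j := by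
    intro j
    rw [LinearMap.trace_eq_matrix_trace k b, Matrix.trace]
    refine Finset.sum_congr rfl fun i _ => ?_
    rw [Matrix.diag_apply, LinearMap.toMatrix_apply, hpow]
    simp
  have hrm : ∀ i, r i ^ m = 1 := by
    intro i
    have h1 := hpow m i
    rw [hu, Module.End.one_apply] at h1
    have h2 : (r i ^ m - 1) • b i = 0 := by rw [sub_smul, ← h1, one_smul, sub_self]
    exact sub_eq_zero.1 ((smul_eq_zero.1 h2).resolve_right (b.ne_zero i))
  have halg : ∀ i, r i ∈ algebraicClosure ℚ k := by
    intro i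
    rw [mem_algebraicClosure_iff]
    exact IsAlgebraic.of_pow hm (by rw [hrm]; exact isAlgebraic_one)
  let z : Fin n → algebraicClosure ℚ k := fun i => ⟨r i, halg i⟩
  have hzm : ∀ i, φ (z i) ^ m = 1 := by
    intro i
    rw [← map_pow, show z i ^ m = 1 from Subtype.ext (hrm i), map_one]
  have hconj : ∀ i, φ (z i) ^ (m - 1) = (starRingEnd ℂ) (φ (z i)) := by
    intro i
    have hne : φ (z i) ≠ 0 := by
      intro h
      have := hzm i
      rw [h, zero_pow hm.ne'] at this
      exact zero_ne_one this
    have h1 : ‖φ (z i)‖ = 1 := Complex.norm_eq_one_of_pow_eq_one (hzm i) hm.ne'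
    have h2 : φ (z i) * (starRingEnd ℂ) (φ (z i)) = 1 := by
      rw [Complex.mul_conj, Complex.normSq_eq_norm_sq, h1]
      simp
    apply mul_left_cancel₀ hne
    rw [h2, ← pow_succ', Nat.sub_add_cancel hm, hzm]
  refine ⟨Complex.normSq (∑ i, φ (z i)), Complex.normSq_nonneg _,
    (∑ i, z i) * ∑ i, z i ^ (m - 1), ?_, ?_⟩
  · have h1 := htr 1
    rw [pow_one] at h1
    rw [h1, htr]
    push_cast
    simp [z]
  · rw [map_mul, map_sum, map_sum, ← Complex.mul_conj, map_sum]
    simp only [map_pow, hconj]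

theorem stdBasis_repr_apply {K : Type*} [Field K] {n : Type*} [Fintype n] [DecidableEq n]
    (x : Matrix n n K) (i j : n) : (Matrix.stdBasis K n n).repr x (i, j) = x i j := by
  simp [Matrix.stdBasis]

theorem trace_mulLeft_comp_mulRight {K : Type*} [Field K] {n : Type*} [Fintype n] [DecidableEq n]
    (a b : Matrix n n K) :
    LinearMap.trace K (Matrix n n K) (LinearMap.mulLeft K a ∘ₗ LinearMap.mulRight K b) =
      a.trace * b.trace := by
  rw [LinearMap.trace_eq_matrix_trace K (Matrix.stdBasis K n n), Matrix.trace,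
    Fintype.sum_prod_type, Matrix.trace, Matrix.trace, Finset.sum_mul_sum]
  refine Finset.sum_congr rfl fun i _ => Finset.sum_congr rfl fun j _ => ?_
  rw [Matrix.diag_apply, LinearMap.toMatrix_apply, Matrix.stdBasis_eq_single, stdBasis_repr_apply]
  simp [Matrix.mul_apply, Matrix.single_apply, ite_and]

/-- An algebra endomorphism of a matrix algebra is inner. -/
theorem exists_conj_matrix {K : Type*} [Field K] {n : ℕ} [NeZero n]
    (τ : Matrix (Fin n) (Fin n) K →ₐ[K] Matrix (Fin n) (Fin n) K) :
    ∃ a b : Matrix (Fin n) (Fin n) K, a * b = 1 ∧ b * a = 1 ∧ ∀ x, τ x = a * x * b := by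
  let E := Matrix.toLinAlgEquiv' (R := K) (n := Fin n)
  let f : Module.End K (Fin n → K) ≃ₐ[K] Module.End K (Fin n → K) :=
    (E.symm.trans (AlgEquiv.ofBijective τ τ.bijective)).trans E
  obtain ⟨T, hT⟩ := f.eq_linearEquivConjAlgEquiv
  refine ⟨E.symm T.toLinearMap, E.symm T.symm.toLinearMap, ?_, ?_, fun x => ?_⟩
  · rw [← map_mul, ← map_one E.symm]
    congr 1
    ext x
    simp
  · rw [← map_mul, ← map_one E.symm]
    congr 1
    ext x
    simp
  · apply E.injective
    have := congr($hT (E x))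
    simp only [f, AlgEquiv.trans_apply, AlgEquiv.symm_apply_apply] at this
    change E (τ x) = _ at this
    rw [this, map_mul, map_mul, AlgEquiv.apply_symm_apply, AlgEquiv.apply_symm_apply]
    rfl

theorem isNonnegUnder_trace_matrix (φ : algebraicClosure ℚ k →+* ℂ) {n : ℕ} [NeZero n]
    (τ : Matrix (Fin n) (Fin n) k →ₐ[k] Matrix (Fin n) (Fin n) k) {m : ℕ} (hm : 0 < m)
    (hτ : ∀ x, τ^[m] x = x) :
    ∃ t, IsNonnegUnder φ t (LinearMap.trace k _ τ.toLinearMap) := by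
  obtain ⟨a, b, hab, hba, hτab⟩ := exists_conj_matrix τ
  have hpow : ∀ j x, τ^[j] x = a ^ j * x * b ^ j := by
    intro j x
    induction j with
    | zero => simp
    | succ j ih =>
      rw [Function.iterate_succ_apply', ih, hτab, pow_succ', pow_succ]
      simp only [mul_assoc]
  have habm : b ^ m * a ^ m = 1 := by
    rw [← Commute.mul_pow (show b * a = a * b by rw [hab, hba]), hba, one_pow]
  -- Since the m-th iterate of τ is the identity, a^m is central, hence a scalar c. Dividing a by an
  -- m-th root of c does not change the conjugation and makes the conjugating matrix of order
  -- dividing m, so the trace is a product as in the previous lemma.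
  obtain ⟨c, hc⟩ : ∃ c : k, algebraMap k _ c = a ^ m := by
    have h1 : a ^ m ∈ Subalgebra.center k (Matrix (Fin n) (Fin n) k) := by
      rw [Subalgebra.mem_center_iff]
      intro x
      have h1 := hpow m x
      rw [hτ] at h1
      conv_lhs => rw [h1]
      rw [mul_assoc, habm, mul_one]
    rw [Algebra.IsCentral.center_eq_bot] at h1
    exact h1
  have hc0 : c ≠ 0 := by
    rintro rfl
    rw [← hc, map_zero, mul_zero] at habm
    exact zero_ne_one habm
  obtain ⟨d, hd⟩ := IsAlgClosed.exists_pow_nat_eq c hm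
  have hd0 : d ≠ 0 := by
    rintro rfl
    rw [zero_pow hm.ne'] at hd
    exact hc0 hd.symm
  have hUm : (d⁻¹ • a) ^ m = 1 := by
    rw [smul_pow, ← hc, ← hd, Algebra.algebraMap_eq_smul_one, smul_smul,
      ← mul_pow, inv_mul_cancel₀ hd0, one_pow, one_smul]
  have hUb : (d⁻¹ • a) ^ (m - 1) = d • b := by
    have h2 : (d⁻¹ • a) * (d • b) = 1 := by simp [hd0, hab]
    calc (d⁻¹ • a) ^ (m - 1) = (d⁻¹ • a) ^ (m - 1) * ((d⁻¹ • a) * (d • b)) := by rw [h2, mul_one]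
      _ = _ := by rw [← mul_assoc, ← pow_succ, Nat.sub_add_cancel hm, hUm, one_mul]
  have hτU : τ.toLinearMap =
      LinearMap.mulLeft k (d⁻¹ • a) ∘ₗ LinearMap.mulRight k ((d⁻¹ • a) ^ (m - 1)) := by
    refine LinearMap.ext fun x => ?_
    rw [hUb]
    simp [hτab, hd0, mul_assoc]
  rw [hτU, trace_mulLeft_comp_mulRight]
  have h3 := isNonnegUnder_trace_mul_trace φ (u := Matrix.toLinAlgEquiv' (d⁻¹ • a)) hm
    (by rw [← map_pow, hUm, map_one])
  rw [← map_pow] at h3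
  have h4 : ∀ x : Matrix (Fin n) (Fin n) k,
      LinearMap.trace k _ (Matrix.toLinAlgEquiv' x) = x.trace := Matrix.trace_toLin'_eq
  rwa [h4, h4] at h3

theorem trace_pi {K ι : Type*} [Field K] [Fintype ι] [DecidableEq ι] {V : ι → Type*}
    [∀ i, AddCommGroup (V i)] [∀ i, Module K (V i)] [∀ i, FiniteDimensional K (V i)]
    (f : (Π i, V i) →ₗ[K] Π i, V i) :
    LinearMap.trace K _ f = ∑ i, LinearMap.trace K (V i)
      (LinearMap.proj i ∘ₗ f ∘ₗ LinearMap.single K V i) := by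
  have h : f = ∑ i, (f ∘ₗ LinearMap.single K V i) ∘ₗ LinearMap.proj i := by
    refine LinearMap.ext fun x => ?_
    conv_lhs => rw [← Finset.univ_sum_single x, map_sum]
    simp
  conv_lhs => rw [h, map_sum]
  exact Finset.sum_congr rfl fun i _ => LinearMap.trace_comp_comm' _ _

/-- The trace of an automorphism of finite order of a product of matrix algebras which preserves
a character of the algebra is nonzero. -/
theorem trace_ne_zero_of_pi_matrix {n : ℕ} {d : Fin n → ℕ} [∀ i, NeZero (d i)]
    (σ : (Π i, Matrix (Fin (d i)) (Fin (d i)) k) ≃ₐ[k] Π i, Matrix (Fin (d i)) (Fin (d i)) k)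
    (ε : (Π i, Matrix (Fin (d i)) (Fin (d i)) k) →ₐ[k] k) (hε : ∀ x, ε (σ x) = ε x)
    {m : ℕ} (hm : 0 < m) (hσ : ∀ x, σ^[m] x = x) :
    LinearMap.trace k _ σ.toLinearMap ≠ 0 := by
  have halg : Algebra.IsAlgebraic ℚ (algebraicClosure ℚ k) := algebraicClosure.isAlgebraic ℚ k
  -- The field k need not embed in ℂ; only its algebraic numbers are needed, since all traces below
  -- are sums of products of roots of unity.
  let φ : algebraicClosure ℚ k →+* ℂ :=
    (IsAlgClosed.lift (R := ℚ) (S := algebraicClosure ℚ k) (M := ℂ)).toRingHom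
  let e : ∀ i, Π i, Matrix (Fin (d i)) (Fin (d i)) k := fun i => Pi.single i 1
  have hcen : ∀ i x, x * e i = e i * x := by
    intro i x
    ext1 j
    by_cases h : j = i
    · subst h; simp [e]
    · simp [e, h]
  have hmulsingle : ∀ i x, x * e i = Pi.single i (x i) := by
    intro i x
    ext1 j
    by_cases h : j = i
    · subst h; simp [e]
    · simp [e, h]
  have hidem : ∀ i, e i * e i = e i := fun i => by rw [hmulsingle]; simp [e]
  have hσcen : ∀ i x, x * σ (e i) = σ (e i) * x := by
    intro i x
    obtain ⟨y, rfl⟩ := σ.surjective x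
    rw [← map_mul, hcen, map_mul]
  have hscalar : ∀ i, (σ (e i)) i = 0 ∨ (σ (e i)) i = 1 := by
    intro i
    obtain ⟨c, hc⟩ : ∃ c : k, algebraMap k _ c = (σ (e i)) i := by
      have h1 : (σ (e i)) i ∈ Subalgebra.center k (Matrix (Fin (d i)) (Fin (d i)) k) := by
        rw [Subalgebra.mem_center_iff]
        intro x
        have := congr($(hσcen i (Pi.single i x)) i)
        simpa using this
      rw [Algebra.IsCentral.center_eq_bot] at h1
      exact h1
    have h2 : (σ (e i)) i * (σ (e i)) i = (σ (e i)) i := by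
      rw [← Pi.mul_apply, ← map_mul, hidem]
    rw [← hc, ← map_mul] at h2
    have h3 := (algebraMap k (Matrix (Fin (d i)) (Fin (d i)) k)).injective h2
    rw [← hc]
    by_cases h : c = 0
    · left; simp [h]
    · right; simp [mul_left_cancel₀ h (h3.trans (mul_one c).symm)]
  -- For central idempotents this says that e ≤ σ(e) implies equality: iterating gives e ≤ σ(e) ≤ …
  -- ≤ σ^m(e) = e.
  have hfix : ∀ i, (σ (e i)) i = 1 → σ (e i) = e i := by
    intro i hi
    have h1 : σ (e i) * e i = e i := by rw [hmulsingle, hi]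
    have h2 : ∀ j, σ^[j + 1] (e i) * σ^[j] (e i) = σ^[j] (e i) := by
      intro j
      induction j with
      | zero => exact h1
      | succ j ih =>
        have h := congr(σ $ih)
        rwa [map_mul, ← Function.iterate_succ_apply' σ, ← Function.iterate_succ_apply' σ] at h
    have h3 : ∀ j, σ^[j + 1] (e i) * σ (e i) = σ (e i) := by
      intro j
      induction j with
      | zero => rw [zero_add, Function.iterate_one, ← map_mul, hidem]
      | succ j ih =>
        conv_lhs => rw [← ih, ← mul_assoc, h2]
        exact ih
    have h4 := h3 (m - 1)
    rw [Nat.sub_add_cancel hm, hσ, ← hcen, h1] at h4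
    exact h4.symm
  let τ : ∀ i, Matrix (Fin (d i)) (Fin (d i)) k →ₗ[k] Matrix (Fin (d i)) (Fin (d i)) k := fun i =>
    LinearMap.proj i ∘ₗ σ.toLinearMap ∘ₗ LinearMap.single k (fun i => Matrix (Fin (d i)) (Fin (d i)) k) i
  have hτalg : ∀ i, (σ (e i)) i = 1 → ∃ τ' : Matrix (Fin (d i)) (Fin (d i)) k →ₐ[k]
      Matrix (Fin (d i)) (Fin (d i)) k, τ'.toLinearMap = τ i ∧ ∀ x, τ'^[m] x = x := by
    intro i hi
    let τ' : Matrix (Fin (d i)) (Fin (d i)) k →ₐ[k] Matrix (Fin (d i)) (Fin (d i)) k :=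
      AlgHom.ofLinearMap (τ i) hi fun x y => by
        change σ (Pi.single i (x * y)) i = σ (Pi.single i x) i * σ (Pi.single i y) i
        rw [← Pi.mul_apply, ← map_mul, Pi.single_mul]
    refine ⟨τ', rfl, fun x => ?_⟩
    have h1 : ∀ y, σ (Pi.single i y) = Pi.single i (τ' y) := by
      intro y
      have h2 : (Pi.single i y : Π i, Matrix (Fin (d i)) (Fin (d i)) k) =
          Pi.single i y * e i := by
        rw [hmulsingle]; simp
      conv_lhs => rw [h2, map_mul, hfix i hi, hmulsingle]
      rfl
    have h3 : ∀ j, σ^[j] (Pi.single i x) = Pi.single i (τ'^[j] x) := by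
      intro j
      induction j with
      | zero => rfl
      | succ j ih => rw [Function.iterate_succ_apply', Function.iterate_succ_apply', ih, h1]
    have h4 := h3 m
    rw [hσ] at h4
    exact (Pi.single_injective i h4).symm
  have hnonneg : ∀ i, ∃ t, IsNonnegUnder φ t (LinearMap.trace k _ (τ i)) := by
    intro i
    rcases hscalar i with hi | hi
    · have h1 : τ i = 0 := by
        refine LinearMap.ext fun x => ?_
        change σ (Pi.single i x) i = 0
        have h2 : (Pi.single i x : Π i, Matrix (Fin (d i)) (Fin (d i)) k) =
          Pi.single i x * e i := by
          rw [hmulsingle]; simp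
        rw [h2, map_mul, Pi.mul_apply, hi, mul_zero]
      exact ⟨0, le_rfl, 0, by simp [h1], by simp⟩
    · obtain ⟨τ', h1, h2⟩ := hτalg i hi
      rw [← h1]
      exact isNonnegUnder_trace_matrix φ τ' hm h2
  obtain ⟨i₀, hi₀⟩ : ∃ i, ε (e i) ≠ 0 := by
    by_contra! h
    have h1 : (1 : Π i, Matrix (Fin (d i)) (Fin (d i)) k) = ∑ i, e i :=
      (Finset.univ_sum_single (1 : Π i, Matrix (Fin (d i)) (Fin (d i)) k)).symm
    have h2 := map_one ε
    rw [h1, map_sum, Finset.sum_eq_zero fun i _ => h i] at h2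
    exact zero_ne_one h2
  have hε₀ : ε (e i₀) = 1 := by
    have h1 : ε (e i₀) * ε (e i₀) = ε (e i₀) := by rw [← map_mul, hidem]
    exact mul_left_cancel₀ hi₀ (by rw [h1, mul_one])
  -- The block supporting the character embeds in k by simplicity, so it consists of scalars. This
  -- block contributes a strictly positive trace.
  have hτ₀ : τ i₀ = LinearMap.id := by
    have hi : (σ (e i₀)) i₀ = 1 := by
      refine (hscalar i₀).resolve_left fun h => ?_
      have h1 : ε (σ (e i₀) * e i₀) = 1 := by rw [map_mul, hε, hε₀, mul_one]
      rw [hmulsingle, h, Pi.single_zero, map_zero] at h1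
      exact zero_ne_one h1
    let ε' : Matrix (Fin (d i₀)) (Fin (d i₀)) k →ₐ[k] k :=
      AlgHom.ofLinearMap (ε.toLinearMap ∘ₗ
        LinearMap.single k (fun i => Matrix (Fin (d i)) (Fin (d i)) k) i₀) hε₀ fun x y => by
        change ε (Pi.single i₀ (x * y)) = ε (Pi.single i₀ x) * ε (Pi.single i₀ y)
        rw [← map_mul, Pi.single_mul]
    have hinj : Function.Injective ε' := ε'.toRingHom.injective
    obtain ⟨τ', h1, h2⟩ := hτalg i₀ hi
    rw [← h1]
    refine LinearMap.ext fun x => ?_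
    have h3 : x = algebraMap k _ (ε' x) := hinj (by rw [AlgHom.commutes]; rfl)
    rw [h3]
    simp
  choose t ht0 z hz hφ using hnonneg
  have htr : LinearMap.trace k _ σ.toLinearMap = ((∑ i, z i : algebraicClosure ℚ k) : k) := by
    rw [trace_pi]
    push_cast
    exact Finset.sum_congr rfl fun i _ => (hz i).symm
  have ht₀ : 0 < t i₀ := by
    refine lt_of_le_of_ne (ht0 i₀) fun h => ?_
    have h1 := hφ i₀
    rw [← h, Complex.ofReal_zero, map_eq_zero] at h1
    have h2 := hz i₀
    rw [h1, hτ₀, LinearMap.trace_id] at h2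
    have h3 : (Module.finrank k (Matrix (Fin (d i₀)) (Fin (d i₀)) k) : k) ≠ 0 := by
      exact_mod_cast Module.finrank_pos.ne'
    exact h3 h2.symm
  rw [htr]
  intro h0
  have h1 : (∑ i, z i) = 0 := Subtype.ext h0
  have h2 := congr(φ $h1)
  rw [map_sum, map_zero] at h2
  simp only [hφ] at h2
  have h3 : ∑ i, t i = 0 := by exact_mod_cast h2
  exact (Finset.sum_pos' (fun i _ => ht0 i) ⟨i₀, Finset.mem_univ _, ht₀⟩).ne' h3

/-- The trace of an automorphism of finite order of a finite-dimensional semisimple algebra which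
preserves a character of the algebra is nonzero. -/
theorem trace_ne_zero_of_iterate_eq {A : Type*} [Ring A] [Algebra k A] [IsSemisimpleRing A]
    [FiniteDimensional k A] (σ : A ≃ₐ[k] A) (ε : A →ₐ[k] k) (hε : ∀ x, ε (σ x) = ε x)
    {m : ℕ} (hm : 0 < m) (hσ : ∀ x, σ^[m] x = x) :
    LinearMap.trace k _ σ.toLinearMap ≠ 0 := by
  obtain ⟨n, d, hd, ⟨E⟩⟩ := IsSemisimpleRing.exists_algEquiv_pi_matrix_of_isAlgClosed k A
  have h := trace_ne_zero_of_pi_matrix ((E.symm.trans σ).trans E) (ε.comp E.symm.toAlgHom)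
    (by simp [hε]) hm fun x => by
      have h1 : ∀ j y, ((E.symm.trans σ).trans E)^[j] y = E (σ^[j] (E.symm y)) := by
        intro j y
        induction j with
        | zero => simp
        | succ j ih => rw [Function.iterate_succ_apply', Function.iterate_succ_apply', ih]; simp
      rw [h1, hσ, AlgEquiv.apply_symm_apply]
  rw [← LinearMap.trace_conj' _ E.toLinearEquiv]
  exact h

end FiniteOrder

end SemisimpleHopf

namespace SemisimpleHopf

/-! ### The Larson–Radford theorem -/

section InvolutiveAntipode

open WithConv Coalgebra HopfAlgebra

variable {k : Type u} [Field k] {H : Type v} [Ring H] [HopfAlgebra k H]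

theorem sliceLeft_comul_sliceLeft_comul (p q : DualAlgebra k H) (x : H) :
    sliceLeft q.ofConv (comul (R := k) (sliceLeft p.ofConv (comul (R := k) x))) =
      sliceLeft (p * q).ofConv (comul (R := k) x) := by
  refine eq_of_forall_dual (k := k) fun f => ?_
  have h1 := dual_mul_apply q (toConv f) (sliceLeft p.ofConv (comul (R := k) x))
  have h2 := dual_mul_apply p (q * toConv f) x
  have h3 := dual_mul_apply (p * q) (toConv f) x
  rw [← mul_assoc] at h2
  exact (h1.symm.trans h2.symm).trans h3

variable (k H) in
/-- The character of the left regular representation. -/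
noncomputable def regularCharacter : H →ₗ[k] k :=
  LinearMap.trace k H ∘ₗ LinearMap.mul k H

theorem regularCharacter_apply (h : H) :
    regularCharacter k H h = LinearMap.trace k H (LinearMap.mulLeft k h) := rfl

variable (k H) in
/-- The Galois map `x ⊗ y ↦ Δ(x) (1 ⊗ y)`. -/
noncomputable def galoisMap : H ⊗[k] H →ₗ[k] H ⊗[k] H :=
  TensorProduct.lift (LinearMap.mk₂ k (fun x y => comul (R := k) x * (1 ⊗ₜ[k] y))
    (fun _ _ _ => by simp [add_mul]) (fun _ _ _ => by simp)
    (fun _ _ _ => by simp [TensorProduct.tmul_add, mul_add]) (fun _ _ _ => by simp))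

theorem galoisMap_tmul (x y : H) :
    galoisMap k H (x ⊗ₜ y) = comul (R := k) x * (1 ⊗ₜ[k] y) := rfl

theorem galoisMap_surjective : Function.Surjective (galoisMap k H) := by
  rw [← LinearMap.range_eq_top, eq_top_iff, ← TensorProduct.span_tmul_eq_top, Submodule.span_le]
  rintro _ ⟨a, b, rfl⟩
  refine ⟨∑ i ∈ (ℛ k a).index, (ℛ k a).left i ⊗ₜ (antipode k ((ℛ k a).right i) * b), ?_⟩
  have h : a ⊗ₜ[k] b = (a ⊗ₜ[k] 1) * (1 ⊗ₜ[k] b) := by simp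
  rw [h, ← sum_comul_mul_one_tmul (ℛ k a), map_sum, Finset.sum_mul]
  simp [galoisMap_tmul, mul_assoc]

/-- The automorphism `S²`. -/
noncomputable def IsNormalizedIntegral.antipodeSq [IsSemisimpleRing H] {l : H}
    (hl : IsNormalizedIntegral k l) : H ≃ₐ[k] H :=
  AlgEquiv.ofBijective (AlgHom.ofLinearMap (antipode k ∘ₗ antipode k) (by simp)
    fun x y => by simp [antipode_mul_antidistrib])
    ⟨hl.antipode_injective.comp hl.antipode_injective,
      hl.antipode_surjective.comp hl.antipode_surjective⟩

theorem IsNormalizedIntegral.antipodeSq_apply [IsSemisimpleRing H] {l : H}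
    (hl : IsNormalizedIntegral k l) (x : H) :
    hl.antipodeSq x = antipode k (antipode k x) := rfl

theorem IsNormalizedIntegral.regularCharacter_antipode_antipode [IsSemisimpleRing H] {l : H}
    (hl : IsNormalizedIntegral k l) (x : H) :
    regularCharacter k H (antipode k (antipode k x)) = regularCharacter k H x := by
  rw [regularCharacter_apply, regularCharacter_apply, ← hl.antipodeSq_apply,
    ← LinearMap.trace_conj' (LinearMap.mulLeft k x) hl.antipodeSq.toLinearEquiv]
  congr 1
  ext y
  simp [LinearEquiv.conj_apply]

variable [FiniteDimensional k H]

/-- The Galois map intertwines h ⊗ id with the diagonal action of h, so H ⊗ H is dim H copies of the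
regular module. -/
theorem regularCharacter_mul_regularCharacter :
    (toConv (regularCharacter k H) * toConv (regularCharacter k H) : DualAlgebra k H) =
      (Module.finrank k H : k) • toConv (regularCharacter k H) := by
  ext h
  rw [(ℛ k h).convMul_apply]
  change ∑ i ∈ _, LinearMap.trace k H (LinearMap.mulLeft k ((ℛ k h).left i)) *
    LinearMap.trace k H (LinearMap.mulLeft k ((ℛ k h).right i)) =
    (Module.finrank k H : k) * LinearMap.trace k H (LinearMap.mulLeft k h)
  simp only [← LinearMap.trace_tensorProduct']
  rw [← map_sum]
  let e := LinearEquiv.ofBijective (galoisMap k H)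
    ⟨LinearMap.injective_iff_surjective.2 galoisMap_surjective, galoisMap_surjective⟩
  have h1 : ∑ i ∈ (ℛ k h).index, TensorProduct.map (LinearMap.mulLeft k ((ℛ k h).left i))
      (LinearMap.mulLeft k ((ℛ k h).right i)) =
      e.conj (TensorProduct.map (LinearMap.mulLeft k h) LinearMap.id) := by
    rw [LinearEquiv.conj_apply, LinearEquiv.eq_comp_toLinearMap_symm]
    refine TensorProduct.ext' fun x y => ?_
    change _ = galoisMap k H ((h * x) ⊗ₜ y)
    have h2 : ∀ t : H ⊗[k] H, (∑ i ∈ (ℛ k h).index, TensorProduct.map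
        (LinearMap.mulLeft k ((ℛ k h).left i)) (LinearMap.mulLeft k ((ℛ k h).right i))) t =
        comul (R := k) h * t := by
      intro t
      rw [← (ℛ k h).eq, Finset.sum_mul, LinearMap.sum_apply]
      refine Finset.sum_congr rfl fun i _ => ?_
      induction t with
      | zero => simp
      | tmul a b => simp
      | add s t hs ht => rw [map_add, hs, ht, mul_add]
    rw [galoisMap_tmul, Bialgebra.comul_mul, mul_assoc]
    exact h2 _
  rw [h1, LinearMap.trace_conj', LinearMap.trace_tensorProduct', LinearMap.trace_id, mul_comm]

variable {l : H}

namespace IsNormalizedIntegral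

theorem regularCharacter_eq (hl : IsNormalizedIntegral k l) : regularCharacter k H l = 1 := by
  have : LinearMap.mulLeft k l = (counit (R := k) (A := H)).smulRight l := by
    ext x
    simp [hl.mul_right]
  rw [regularCharacter_apply, this, LinearMap.trace_smulRight, hl.counit_eq]

variable [IsSemisimpleRing H]

/-- By Radford's formula S⁴ is conjugation by g, which has finite order m; so S² has order dividing
2m. -/
theorem exists_iterate_antipodeSq (hl : IsNormalizedIntegral k l) :
    ∃ m, 0 < m ∧ ∀ x, hl.antipodeSq^[m] x = x := by
  obtain ⟨m, hm, hg⟩ := hl.exists_modularElement_pow_eq_one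
  refine ⟨2 * m, by omega, fun x => ?_⟩
  have h : ∀ j, (hl.antipodeSq^[2])^[j] x * modularElement k l ^ j =
      modularElement k l ^ j * x := by
    intro j
    induction j with
    | zero => simp
    | succ j ih =>
      rw [Function.iterate_succ_apply', pow_succ', ← mul_assoc]
      have h1 := hl.modularElement_mul ((hl.antipodeSq^[2])^[j] x)
      change _ = hl.antipodeSq^[2] ((hl.antipodeSq^[2])^[j] x) * _ at h1
      rw [← h1, mul_assoc, ih, mul_assoc]
  have h2 := h m
  rwa [hg, mul_one, one_mul, ← Function.iterate_mul] at h2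

variable [IsAlgClosed k] [CharZero k]

theorem antipodeTrace_one_ne_zero (hl : IsNormalizedIntegral k l) : antipodeTrace k H 1 ≠ 0 := by
  obtain ⟨m, hm, h⟩ := hl.exists_iterate_antipodeSq
  rw [← hl.trace_antipode_antipode]
  exact trace_ne_zero_of_iterate_eq hl.antipodeSq (Bialgebra.counitAlgHom k H)
    (fun x => by simp [antipodeSq_apply]) hm h

/-- Evaluating pλ = p(g)λ at 1 gives p(1)λ(1) = p(g)λ(1), and λ(1) = tr S² is nonzero. -/
theorem modularElement_eq_one (hl : IsNormalizedIntegral k l) : modularElement k l = 1 := by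
  refine eq_of_forall_dual (k := k) fun q => ?_
  have h1 := congr(($(hl.mul_antipodeTrace (toConv q))).ofConv 1)
  rw [dual_mul_apply'] at h1
  change q (sliceRight (antipodeTrace k H) (comul (R := k) 1)) =
    q (modularElement k l) * antipodeTrace k H 1 at h1
  rw [Bialgebra.comul_one, Algebra.TensorProduct.one_def, sliceRight_tmul, map_smul, smul_eq_mul,
    mul_comm] at h1
  exact (mul_right_cancel₀ hl.antipodeTrace_one_ne_zero h1).symm

theorem antipode_pow_four (hl : IsNormalizedIntegral k l) (x : H) :
    antipode k (antipode k (antipode k (antipode k x))) = x := by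
  have := hl.modularElement_mul x
  rw [hl.modularElement_eq_one, one_mul, mul_one] at this
  exact this.symm

end IsNormalizedIntegral

theorem exists_trace_eq_natCast {V : Type*} [AddCommGroup V] [Module k V] [FiniteDimensional k V]
    {f : Module.End k V} (hf : IsIdempotentElem f) :
    ∃ n ≤ Module.finrank k V, LinearMap.trace k V f = n :=
  ⟨_, Submodule.finrank_le _, (LinearMap.IsIdempotentElem.isProj_range f hf).trace⟩

/-- An involution `T` commuting with an idempotent `L` such that
`tr T = (dim V) tr (T L)` is nonzero is `±1`. -/
theorem eq_one_or_eq_neg_one_of_trace {k : Type*} [Field k] [CharZero k] {V : Type*}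
    [AddCommGroup V] [Module k V] [FiniteDimensional k V] {T L : Module.End k V} (hT : T * T = 1)
    (hL : IsIdempotentElem L) (hTL : Commute T L) (h0 : LinearMap.trace k V T ≠ 0)
    (h : LinearMap.trace k V T = Module.finrank k V * LinearMap.trace k V (T * L)) :
    T = 1 ∨ T = -1 := by
  let P : Module.End k V := (2⁻¹ : k) • (1 + T)
  have hP : IsIdempotentElem P := by
    have h1 : (1 + T) * (1 + T) = (2 : k) • (1 + T) := by
      rw [mul_add, add_mul, add_mul, hT, two_smul]
      simp only [one_mul, mul_one]
      abel
    change P * P = P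
    simp only [P]
    rw [smul_mul_smul_comm, h1, smul_smul]
    congr 1
    norm_num
  have hTP : T = (2 : k) • P - 1 := by
    simp only [P]
    rw [smul_smul, mul_inv_cancel₀ two_ne_zero, one_smul, add_sub_cancel_left]
  have hPL : Commute P L := ((Commute.one_left L).add_left hTL).smul_left _
  obtain ⟨r, hr, hrP⟩ := exists_trace_eq_natCast hP
  obtain ⟨s, -, hs⟩ := exists_trace_eq_natCast hL
  obtain ⟨q, -, hq⟩ := exists_trace_eq_natCast (hP.mul_of_commute hPL hL)
  have h1 : LinearMap.trace k V T = 2 * r - Module.finrank k V := by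
    rw [hTP, map_sub, map_smul, hrP, LinearMap.trace_one, smul_eq_mul]
  have h2 : LinearMap.trace k V (T * L) = 2 * q - s := by
    rw [hTP, sub_mul, smul_mul_assoc, one_mul, map_sub, map_smul, hq, hs, smul_eq_mul]
  rw [h2, h1] at h
  rw [h1] at h0
  set n := Module.finrank k V with hn
  have h3 : (2 * r - n : ℤ) = n * (2 * q - s) := by exact_mod_cast h
  have h4 : (2 * r - n : ℤ) ≠ 0 := by exact_mod_cast h0
  -- The trace 2r - n of T is nonzero, lies between -n and n, and equals n times the integer 2q - s;
  -- hence that integer is ±1 and r is n or 0.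
  have h5 : (2 * (q : ℤ) - s) = 1 ∨ (2 * (q : ℤ) - s) = -1 := by
    have hn0 : (0 : ℤ) ≤ n := by positivity
    have hz : (2 * (q : ℤ) - s) ≠ 0 := fun hz => h4 (by rw [h3, hz, mul_zero])
    have hn1 : (n : ℤ) ≠ 0 := fun hz => h4 (by rw [h3, hz, zero_mul])
    have hr' : (r : ℤ) ≤ n := by exact_mod_cast hr
    have hr0 : (0 : ℤ) ≤ r := by positivity
    have hn2 : (0 : ℤ) < n := lt_of_le_of_ne hn0 hn1.symm
    have h6 : (2 * (q : ℤ) - s) ≤ 1 := by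
      by_contra! hc
      nlinarith
    have h7 : -1 ≤ (2 * (q : ℤ) - s) := by
      by_contra! hc
      nlinarith
    omega
  rcases h5 with h5 | h5
  · left
    have hrn : r = n := by
      rw [h5] at h3
      omega
    have h6 : (1 - P) = 0 := by
      refine LinearMap.IsIdempotentElem.eq_zero_of_trace_eq_zero hP.one_sub ?_
      rw [map_sub, hrP, hrn, LinearMap.trace_one, sub_self]
    rw [hTP, ← sub_eq_zero.1 h6, two_smul, add_sub_cancel_right]
  · right
    have hrn : r = 0 := by
      rw [h5] at h3
      omega
    have h6 : P = 0 := by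
      refine LinearMap.IsIdempotentElem.eq_zero_of_trace_eq_zero hP ?_
      rw [hrP, hrn, Nat.cast_zero]
    rw [hTP, h6, smul_zero, zero_sub]

/-- **Larson–Radford**: the antipode of a semisimple Hopf algebra in characteristic `0` is an
involution. -/
theorem IsNormalizedIntegral.antipode_antipode [IsSemisimpleRing H] [IsAlgClosed k] [CharZero k]
    (hl : IsNormalizedIntegral k l) (x : H) : antipode k (antipode k x) = x := by
  have : Nontrivial H := Bialgebra.nontrivial (R := k)
  let χ : DualAlgebra k H := toConv (regularCharacter k H)
  let T : Module.End k H := antipode k ∘ₗ antipode k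
  let X : Module.End k H := sliceLeft χ.ofConv ∘ₗ comul (R := k)
  have hn : (Module.finrank k H : k) ≠ 0 := by exact_mod_cast Module.finrank_pos.ne'
  have hXX : X * X = (Module.finrank k H : k) • X := by
    refine LinearMap.ext fun x => ?_
    change sliceLeft χ.ofConv (comul (R := k) (sliceLeft χ.ofConv (comul (R := k) x))) = _
    rw [sliceLeft_comul_sliceLeft_comul, regularCharacter_mul_regularCharacter,
      sliceLeft_comul (ℛ k x), LinearMap.smul_apply]
    change _ = _ • sliceLeft χ.ofConv (comul (R := k) x)
    rw [sliceLeft_comul (ℛ k x), Finset.smul_sum]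
    exact Finset.sum_congr rfl fun i _ =>
      mul_smul (Module.finrank k H : k) (χ.ofConv ((ℛ k x).left i)) _
  have hTX : Commute T X := by
    refine LinearMap.ext fun x => ?_
    change antipode k (antipode k (sliceLeft χ.ofConv (comul (R := k) x))) =
      sliceLeft χ.ofConv (comul (R := k) (antipode k (antipode k x)))
    let r' : Repr k (antipode k x) (H × H) :=
      { index := (ℛ k x).index
        left := fun i => antipode k ((ℛ k x).right i)
        right := fun i => antipode k ((ℛ k x).left i)
        eq := (comul_antipode (ℛ k x)).symm }
    rw [comul_antipode r', sliceLeft_comul (ℛ k x)]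
    simp only [map_sum, map_smul, sliceLeft_tmul]
    refine Finset.sum_congr rfl fun i _ => ?_
    change _ = regularCharacter k H (antipode k (antipode k _)) • _
    rw [hl.regularCharacter_antipode_antipode]
  have htr : LinearMap.trace k H (T * X) = LinearMap.trace k H T := by
    change LinearMap.trace k H (antipode k ∘ₗ antipode k ∘ₗ sliceLeft (regularCharacter k H) ∘ₗ
      comul (R := k)) = LinearMap.trace k H (antipode k ∘ₗ antipode k)
    rw [hl.trace_antipode_antipode_sliceLeft, hl.regularCharacter_eq, one_mul,
      hl.trace_antipode_antipode]
  have hTne : LinearMap.trace k H T ≠ 0 := by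
    change LinearMap.trace k H (antipode k ∘ₗ antipode k) ≠ 0
    rw [hl.trace_antipode_antipode]
    exact hl.antipodeTrace_one_ne_zero
  -- With n = dim H, the operator X/n is idempotent because χ² = nχ, and tr(S²X) = χ(Λ)λ(1) = tr S².
  -- The outcome S² = -1 is excluded because S²(1) = 1.
  have h := eq_one_or_eq_neg_one_of_trace (T := T) (L := (Module.finrank k H : k)⁻¹ • X)
    (LinearMap.ext hl.antipode_pow_four)
    (by
      rw [IsIdempotentElem, smul_mul_smul_comm, hXX, smul_smul, mul_assoc, inv_mul_cancel₀ hn,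
        mul_one])
    (hTX.smul_right _) hTne
    (by rw [mul_smul_comm, map_smul, htr, smul_eq_mul, ← mul_assoc, mul_inv_cancel₀ hn, one_mul])
  rcases h with h | h
  · exact congr($h x)
  · have h1 : antipode k (antipode k (1 : H)) = -1 := congr($h 1)
    rw [antipode_one, antipode_one] at h1
    have h2 := congr(counit (R := k) $h1)
    rw [map_neg, Bialgebra.counit_one] at h2
    have h3 : (2 : k) = 0 := by linear_combination h2
    exact absurd h3 two_ne_zero

end InvolutiveAntipode

end SemisimpleHopf

namespace SemisimpleHopf

/-! ### Characters and trace functions of semisimple algebras -/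

section ClassFunctions

variable {k : Type u} [Field k] {A : Type v} [Ring A] [Algebra k A]

theorem character_congr {V W : Type*} [AddCommGroup V] [Module k V] [Module A V]
    [IsScalarTower k A V] [AddCommGroup W] [Module k W] [Module A W] [IsScalarTower k A W]
    (e : V ≃ₗ[A] W) : character k A V = character k A W := by
  ext a
  change LinearMap.trace k V (Algebra.lsmul k k V a) = LinearMap.trace k W (Algebra.lsmul k k W a)
  rw [← LinearMap.trace_conj' _ (e.restrictScalars k)]
  congr 1
  ext x
  simp [LinearEquiv.conj_apply]

theorem character_mul_comm (V : Type*) [AddCommGroup V] [Module k V] [Module A V]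
    [IsScalarTower k A V] (a b : A) : character k A V (a * b) = character k A V (b * a) := by
  change LinearMap.trace k V (Algebra.lsmul k k V (a * b)) =
    LinearMap.trace k V (Algebra.lsmul k k V (b * a))
  rw [map_mul (Algebra.lsmul k k V), map_mul (Algebra.lsmul k k V), LinearMap.trace_mul_comm]

theorem mul_comm_of_mem_characterSpace {f : A →ₗ[k] k} (hf : f ∈ characterSpace k A) (a b : A) :
    f (a * b) = f (b * a) := by
  induction hf using Submodule.span_induction with
  | mem f hf =>
    obtain ⟨V, _, _, _, _, _, _, rfl⟩ := hf
    exact character_mul_comm V a b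
  | zero => rfl
  | add f g _ _ hf hg => rw [LinearMap.add_apply, LinearMap.add_apply, hf, hg]
  | smul c f _ hf => rw [LinearMap.smul_apply, LinearMap.smul_apply, hf]

/-- A full matrix representation affords an irreducible character, in any universe. -/
theorem trace_comp_mem_characterSpace {V : Type*} [AddCommGroup V] [Module k V] [Nontrivial V]
    [FiniteDimensional k V] [FiniteDimensional k A] (ρ : A →ₐ[k] Module.End k V)
    (hρ : Function.Surjective ρ) :
    LinearMap.trace k V ∘ₗ ρ.toLinearMap ∈ characterSpace k A := by
  let _ : Module A V := Module.compHom V ρ.toRingHom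
  have hsmul : ∀ (a : A) (x : V), a • x = ρ a x := fun _ _ => rfl
  have : IsScalarTower k A V := ⟨fun c a x => by simp [hsmul]⟩
  have htrans : ∀ x : V, x ≠ 0 → Function.Surjective (LinearMap.toSpanSingleton A V x) := by
    intro x hx y
    obtain ⟨f, hf⟩ := Module.Projective.exists_dual_eq_one k hx
    obtain ⟨a, ha⟩ := hρ (f.smulRight y)
    exact ⟨a, by rw [LinearMap.toSpanSingleton_apply, hsmul, ha]; simp [hf]⟩
  have hsimple : IsSimpleModule A V :=
    isSimpleModule_iff_toSpanSingleton_surjective.2 ⟨inferInstance, htrans⟩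
  obtain ⟨x, hx⟩ := exists_ne (0 : V)
  -- The module is replaced by a cyclic quotient of A, which lives in the universe required by
  -- `irreducibleCharacters`.
  let e := (LinearMap.toSpanSingleton A V x).quotKerEquivOfSurjective (htrans x hx)
  have : IsSimpleModule A (A ⧸ LinearMap.ker (LinearMap.toSpanSingleton A V x)) :=
    IsSimpleModule.congr e
  have : FiniteDimensional k (A ⧸ LinearMap.ker (LinearMap.toSpanSingleton A V x)) :=
    Module.Finite.equiv (e.symm.restrictScalars k)
  have h := character_mem_characterSpace (A := A) k
    (A ⧸ LinearMap.ker (LinearMap.toSpanSingleton A V x))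
  rw [character_congr e] at h
  exact h

theorem exists_eq_smul_trace_of_mul_comm {n : ℕ} [NeZero n]
    (f : Matrix (Fin n) (Fin n) k →ₗ[k] k) (hf : ∀ a b, f (a * b) = f (b * a)) :
    ∃ c : k, ∀ x, f x = c * x.trace := by
  refine ⟨f (Matrix.single 0 0 1), fun x => ?_⟩
  have hdiag : ∀ i, f (Matrix.single i i 1) = f (Matrix.single 0 0 1) := by
    intro i
    have := hf (Matrix.single i 0 1) (Matrix.single 0 i 1)
    simpa using this
  have hoff : ∀ i j, i ≠ j → f (Matrix.single i j 1) = 0 := by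
    intro i j hij
    have := hf (Matrix.single i i 1) (Matrix.single i j 1)
    simpa [Matrix.single_mul_single_of_ne, hij.symm] using this
  have hsingle : ∀ i j, f (Matrix.single i j (x i j)) = x i j * f (Matrix.single i j 1) := by
    intro i j
    rw [← smul_eq_mul, ← map_smul, Matrix.smul_single, smul_eq_mul, mul_one]
  conv_lhs => rw [Matrix.matrix_eq_sum_single x, map_sum]
  rw [Matrix.trace, Finset.mul_sum]
  refine Finset.sum_congr rfl fun i _ => ?_
  rw [map_sum, Finset.sum_eq_single i, hsingle, hdiag, mul_comm, Matrix.diag_apply]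
  · intro j _ hj
    rw [hsingle, hoff i j hj.symm, mul_zero]
  · simp

variable [IsAlgClosed k] [FiniteDimensional k A] [IsSemisimpleRing A]

/-- `R(A)` consists of the trace functions on a semisimple algebra `A`. -/
theorem mem_characterSpace_of_mul_comm {f : A →ₗ[k] k} (hf : ∀ a b, f (a * b) = f (b * a)) :
    f ∈ characterSpace k A := by
  obtain ⟨n, d, hd, ⟨E⟩⟩ := IsSemisimpleRing.exists_algEquiv_pi_matrix_of_isAlgClosed k A
  let g : ∀ i, Matrix (Fin (d i)) (Fin (d i)) k →ₗ[k] k := fun i =>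
    f ∘ₗ E.symm.toLinearMap ∘ₗ LinearMap.single k (fun i => Matrix (Fin (d i)) (Fin (d i)) k) i
  have hg : ∀ i, ∃ c : k, ∀ x, g i x = c * x.trace := by
    intro i
    refine exists_eq_smul_trace_of_mul_comm (g i) fun a b => ?_
    change f (E.symm (Pi.single i (a * b))) = f (E.symm (Pi.single i (b * a)))
    rw [Pi.single_mul, Pi.single_mul, map_mul E.symm, map_mul E.symm, hf]
  choose c hc using hg
  let ρ : ∀ i, A →ₐ[k] Module.End k (Fin (d i) → k) := fun i =>
    (Matrix.toLinAlgEquiv' (R := k) (n := Fin (d i))).toAlgHom.comp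
      ((Pi.evalAlgHom k (fun i => Matrix (Fin (d i)) (Fin (d i)) k) i).comp E.toAlgHom)
  have hρ : ∀ i, Function.Surjective (ρ i) := by
    intro i y
    refine ⟨E.symm (Pi.single i (Matrix.toLinAlgEquiv'.symm y)), ?_⟩
    simp [ρ]
  have hfsum : f = ∑ i, c i • (LinearMap.trace k (Fin (d i) → k) ∘ₗ (ρ i).toLinearMap) := by
    ext a
    have h1 : f a = ∑ i, g i (E a i) := by
      conv_lhs => rw [← E.symm_apply_apply a, ← Finset.univ_sum_single (E a), map_sum, map_sum]
      rfl
    rw [h1, LinearMap.sum_apply]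
    refine Finset.sum_congr rfl fun i _ => ?_
    rw [hc, LinearMap.smul_apply, smul_eq_mul]
    congr 1
    exact (Matrix.trace_toLin'_eq (E a i)).symm
  rw [hfsum]
  exact Submodule.sum_mem _ fun i _ => Submodule.smul_mem _ _
    (trace_comp_mem_characterSpace (ρ i) (hρ i))

end ClassFunctions

end SemisimpleHopf

namespace SemisimpleHopf

/-! ### Consequences of S² = id: the symmetric form and the adjoint action -/

section SymmetricForm

open WithConv Coalgebra HopfAlgebra

variable {k : Type u} [Field k] {H : Type v} [Ring H] [HopfAlgebra k H]

/-- The coproduct of `S(a)`, expanded along that of `a`. -/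
@[simps]
noncomputable def reprAntipode {ι : Type*} {a : H} (r : Repr k a ι) : Repr k (antipode k a) ι where
  index := r.index
  left i := antipode k (r.right i)
  right i := antipode k (r.left i)
  eq := (comul_antipode r).symm

theorem leftAdjoint_eq_sum {ι : Type*} {h : H} (r : Repr k h ι) (m : H) :
    leftAdjoint k h m = ∑ i ∈ r.index, r.left i * m * antipode k (r.right i) := by
  rw [leftAdjoint, ← r.eq]
  simp

theorem counit_leftAdjoint (h m : H) :
    counit (R := k) (leftAdjoint k h m) = counit (R := k) h * counit (R := k) m := by
  rw [leftAdjoint_eq_sum (ℛ k h), map_sum]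
  simp only [Bialgebra.counit_mul, counit_antipode]
  conv_rhs => rw [← sum_counit_smul (ℛ k h), map_sum, Finset.sum_mul]
  refine Finset.sum_congr rfl fun i _ => ?_
  rw [map_smul, smul_eq_mul]
  ring

variable {l : H}

/-- Averaging by Λ makes elements central: ad_Λ(m) is the image of the Casimir tensor under x ⊗ y ↦
xmy, and h moves across that tensor. -/
theorem IsNormalizedIntegral.leftAdjoint_comm (hl : IsNormalizedIntegral k l) (m h : H) :
    h * leftAdjoint k l m = leftAdjoint k l m * h := by
  let F : H ⊗[k] H →ₗ[k] H := LinearMap.mul' k H ∘ₗ (LinearMap.mulRight k m).rTensor H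
  have hF : leftAdjoint k l m = F ((antipode k).lTensor H (comul (R := k) l)) := by
    rw [leftAdjoint_eq_sum (ℛ k l), ← (ℛ k l).eq]
    simp [F]
  have h1 : ∀ t, F ((h ⊗ₜ[k] 1) * t) = h * F t := by
    intro t
    induction t with
    | zero => simp
    | tmul a b => simp [F, mul_assoc]
    | add s t hs ht => simp [mul_add, hs, ht]
  have h2 : ∀ t, F (t * (1 ⊗ₜ[k] h)) = F t * h := by
    intro t
    induction t with
    | zero => simp
    | tmul a b => simp [F, mul_assoc]
    | add s t hs ht => simp [add_mul, hs, ht]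
  rw [hF, ← h1, hl.casimir, h2]

theorem IsNormalizedIntegral.leftAdjoint_eq_self (hl : IsNormalizedIntegral k l) {w : H}
    (hw : ∀ h, h * w = w * h) : leftAdjoint k l w = w := by
  rw [leftAdjoint_eq_sum (ℛ k l)]
  simp only [hw, mul_assoc]
  rw [← Finset.mul_sum, sum_mul_antipode_eq_algebraMap_counit, hl.counit_eq, map_one, mul_one]

variable [FiniteDimensional k H]

namespace IsNormalizedIntegral

variable [IsSemisimpleRing H] [IsAlgClosed k] [CharZero k]

theorem antipodeTrace_eq_trace_mulRight (hl : IsNormalizedIntegral k l) (h : H) :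
    antipodeTrace k H h = LinearMap.trace k H (LinearMap.mulRight k h) := by
  rw [antipodeTrace_apply]
  congr 1
  ext x
  simp [hl.antipode_antipode]

theorem antipodeTrace_comm (hl : IsNormalizedIntegral k l) (a b : H) :
    antipodeTrace k H (a * b) = antipodeTrace k H (b * a) := by
  rw [hl.antipodeTrace_mul_comm, hl.antipode_antipode]

theorem antipodeTrace_antipode (hl : IsNormalizedIntegral k l) (h : H) :
    antipodeTrace k H (antipode k h) = antipodeTrace k H h := by
  rw [← hl.antipodeTrace_modularElement_mul_antipode h, hl.modularElement_eq_one, one_mul]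

/-- `λ(h₂) h₁ = λ(h) 1`. -/
theorem sliceRight_antipodeTrace (hl : IsNormalizedIntegral k l) (h : H) :
    sliceRight (antipodeTrace k H) (comul (R := k) h) = antipodeTrace k H h • 1 := by
  refine eq_of_forall_dual (k := k) fun q => ?_
  have h1 := congr(($(hl.mul_antipodeTrace (toConv q))).ofConv h)
  rw [dual_mul_apply', hl.modularElement_eq_one] at h1
  rw [map_smul, smul_eq_mul, mul_comm]
  exact h1

/-- `h₁ λ(h₂ m) = λ(h m₂) S(m₁)`. -/
theorem sliceRight_comul_mul (hl : IsNormalizedIntegral k l) {ι : Type*} {m : H}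
    (r : Repr k m ι) (h : H) :
    sliceRight (antipodeTrace k H) (comul (R := k) h * (1 ⊗ₜ[k] m)) =
      ∑ i ∈ r.index, antipodeTrace k H (h * r.right i) • antipode k (r.left i) := by
  have h1 := sum_comul_antipode_mul_tmul_one (reprAntipode r)
  simp only [reprAntipode_index, reprAntipode_left, reprAntipode_right,
    hl.antipode_antipode] at h1
  rw [← h1, Finset.mul_sum, map_sum]
  refine Finset.sum_congr rfl fun i _ => ?_
  rw [← mul_assoc, ← Bialgebra.comul_mul, sliceRight_mul_tmul_one, hl.sliceRight_antipodeTrace,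
    smul_mul_assoc, one_mul]

/-- `h₁ λ(a h₂) = λ(a₂ h) S(a₁)`. -/
theorem sliceRight_mul_comul (hl : IsNormalizedIntegral k l) {ι : Type*} {a : H}
    (r : Repr k a ι) (h : H) :
    sliceRight (antipodeTrace k H) ((1 ⊗ₜ[k] a) * comul (R := k) h) =
      ∑ i ∈ r.index, antipodeTrace k H (r.right i * h) • antipode k (r.left i) := by
  rw [← sum_tmul_one_mul_comul r, Finset.sum_mul, map_sum]
  refine Finset.sum_congr rfl fun i _ => ?_
  rw [mul_assoc, ← Bialgebra.comul_mul, sliceRight_tmul_one_mul, hl.sliceRight_antipodeTrace,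
    mul_smul_comm, mul_one]

/-- In characteristic 0 the trace of an idempotent operator is its rank, and λ(f) is the trace of
right multiplication by f. -/
theorem eq_zero_of_isIdempotentElem (hl : IsNormalizedIntegral k l) {f : H}
    (hf : IsIdempotentElem f) (h0 : antipodeTrace k H f = 0) : f = 0 := by
  rw [hl.antipodeTrace_eq_trace_mulRight] at h0
  have h1 : IsIdempotentElem (LinearMap.mulRight k f : Module.End k H) := by
    refine LinearMap.ext fun x => ?_
    change x * f * f = x * f
    rw [mul_assoc, hf.eq]
  have h2 := congr($(LinearMap.IsIdempotentElem.eq_zero_of_trace_eq_zero h1 h0) 1)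
  simpa using h2

theorem antipodeTrace_eq_zero_of_isNilpotent (hl : IsNormalizedIntegral k l) {x : H}
    (hx : IsNilpotent x) : antipodeTrace k H x = 0 := by
  rw [hl.antipodeTrace_eq_trace_mulRight]
  have h1 : IsNilpotent (LinearMap.mulRight k x : Module.End k H) := by
    obtain ⟨n, hn⟩ := hx
    exact ⟨n, by rw [LinearMap.pow_mulRight, hn]; simp⟩
  exact (LinearMap.isNilpotent_trace_of_isNilpotent h1).eq_zero

/-- The trace formula gives λ(S(Λ₂)hΛ₁m), and symmetry of λ moves S(Λ₂) to the right end. This is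
how the adjoint action enters induced characters. -/
theorem trace_mulLeft_comp_mulRight_eq (hl : IsNormalizedIntegral k l) (h m : H) :
    LinearMap.trace k H (LinearMap.mulLeft k h ∘ₗ LinearMap.mulRight k m) =
      antipodeTrace k H (h * leftAdjoint k l m) := by
  rw [hl.trace_eq (ℛ k l), leftAdjoint, ← (ℛ k l).eq]
  simp only [map_sum, TensorProduct.map_tmul, LinearMap.mul'_apply, Finset.mul_sum,
    LinearMap.comp_apply, LinearMap.mulRight_apply, LinearMap.mulLeft_apply]
  refine Finset.sum_congr rfl fun i _ => ?_
  rw [hl.antipodeTrace_comm]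
  simp only [mul_assoc]

end IsNormalizedIntegral

end SymmetricForm

end SemisimpleHopf

namespace SemisimpleHopf

/-! ### Idempotents and nil left ideals -/

section NilIdeals

variable {k : Type u} [Field k] {A : Type v} [Ring A] [Algebra k A]

/-- Fitting's argument: write the minimal polynomial as X^r q with q prime to X, and sX^(r+1) + tq =
1. Then s(x)x^(r+1) is idempotent, and it vanishes only if x^r = 0. -/
theorem exists_isIdempotentElem_mul [FiniteDimensional k A] {x : A} (hx : ¬ IsNilpotent x) :
    ∃ y : A, IsIdempotentElem (y * x) ∧ y * x ≠ 0 := by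
  open Polynomial in
  have hp : minpoly k x ≠ 0 := minpoly.ne_zero (Algebra.IsIntegral.isIntegral x)
  obtain ⟨q, hq, hdvd⟩ := exists_eq_pow_rootMultiplicity_mul_and_not_dvd (minpoly k x) hp 0
  set r := rootMultiplicity 0 (minpoly k x)
  rw [C_0, sub_zero] at hq hdvd
  have hcop : IsCoprime (X ^ (r + 1)) q :=
    ((irreducible_X.coprime_iff_not_dvd).2 hdvd).pow_left
  obtain ⟨s, t, hst⟩ := hcop
  have hroot : x ^ r * aeval x q = 0 := by
    have := minpoly.aeval k x
    rw [hq, map_mul, map_pow, aeval_X] at this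
    exact this
  have hsum : aeval x s * x ^ (r + 1) + aeval x t * aeval x q = 1 := by
    simpa using congr(aeval x $hst)
  have hcomm : ∀ p : k[X], x ^ r * aeval x p = aeval x p * x ^ r := by
    intro p
    simpa using congr(aeval x $(mul_comm (X ^ r) p))
  have hker : x ^ r * (aeval x t * aeval x q) = 0 := by
    rw [← mul_assoc, hcomm, mul_assoc, hroot, mul_zero]
  refine ⟨aeval x s * x ^ r, ?_, fun h0 => hx ⟨r, ?_⟩⟩
  · rw [mul_assoc, ← pow_succ]
    have h1 : aeval x s * x ^ (r + 1) * (aeval x t * aeval x q) = 0 := by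
      rw [pow_succ', mul_assoc, mul_assoc, hker, mul_zero, mul_zero]
    rw [eq_sub_of_add_eq' hsum, mul_sub, mul_one, sub_eq_zero] at h1
    exact h1.symm
  · rw [mul_assoc, ← pow_succ] at h0
    rw [h0, zero_add] at hsum
    rwa [hsum, mul_one] at hker

theorem le_jacobson_bot_of_forall_isNilpotent {I : Ideal A} (hI : ∀ x ∈ I, IsNilpotent x) :
    I ≤ Ideal.jacobson ⊥ := by
  intro x hx
  rw [Ideal.mem_jacobson_iff]
  intro y
  obtain ⟨z, hz⟩ := (hI _ (I.mul_mem_left y hx)).isUnit_one_add.exists_left_inv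
  refine ⟨z, ?_⟩
  rw [Ideal.mem_bot, ← hz]
  noncomm_ring

end NilIdeals

/-! ### Nondegeneracy of the form on N and semisimplicity of N -/

section CoidealSubalgebras

open WithConv Coalgebra HopfAlgebra

variable {k : Type u} [Field k] {H : Type v} [Ring H] [HopfAlgebra k H] {N : Subalgebra k H}

theorem IsLeftCoideal.sliceLeft_mem (hN : IsLeftCoideal N) {n : H} (hn : n ∈ N)
    (f : H →ₗ[k] k) : sliceLeft f (comul (R := k) n) ∈ N := by
  obtain ⟨t, ht⟩ := hN n hn
  rw [← ht]
  clear ht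
  induction t with
  | zero => simp
  | tmul a b => simpa using N.smul_mem b.2 (f a)
  | add s t hs ht => simpa using N.add_mem hs ht

theorem sum_basis_tmul_sliceLeft {ι : Type*} [Fintype ι] (b : Module.Basis ι k H)
    (t : H ⊗[k] H) : ∑ i, b i ⊗ₜ[k] sliceLeft (b.coord i) t = t := by
  induction t with
  | zero => simp
  | tmul x y =>
    simp only [sliceLeft_tmul, ← TensorProduct.smul_tmul, ← TensorProduct.sum_tmul,
      Module.Basis.coord_apply, b.sum_repr]
  | add s t hs ht => simp only [map_add, TensorProduct.tmul_add, Finset.sum_add_distrib, hs, ht]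

variable [FiniteDimensional k H]

variable (k) in
/-- The coproduct expanded along a basis of `H` in the left factor. -/
@[simps]
noncomputable def basisRepr (a : H) : Repr k a (Fin (Module.finrank k H)) where
  index := Finset.univ
  left := Module.finBasis k H
  right i := sliceLeft ((Module.finBasis k H).coord i) (comul (R := k) a)
  eq := sum_basis_tmul_sliceLeft _ _

/-- A left ideal of `N` stable under the coaction lies in the kernel of the counit
if it lies in the radical. -/
theorem counit_eq_zero_of_le_jacobson (J : Ideal N) (hJ : J ≤ Ideal.jacobson ⊥) {n : N}
    (hn : ∀ f : H →ₗ[k] k, ∃ m ∈ J, (m : H) = sliceLeft f (comul (R := k) (n : H))) :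
    counit (R := k) (n : H) = 0 := by
  by_contra hε
  let M : Ideal N → Submodule k H := fun K => (K.restrictScalars k).map N.val.toLinearMap
  have hM : ∀ (K : Ideal N) (m : N), m ∈ K → (m : H) ∈ M K := fun K m hm => ⟨m, hm, rfl⟩
  let R : Ideal N := Ideal.jacobson ⊥
  -- Since ε(n)1 = S(n₁)n₂ lies in HR, a nonzero ε(n) forces HR = H, hence HR^m = H for all m,
  -- against nilpotency of the radical R.
  have h1 : (1 : H) ∈ ⊤ * M R := by
    have h2 : counit (R := k) (n : H) • (1 : H) ∈ ⊤ * M R := by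
      rw [← sum_antipode_mul_eq_smul (basisRepr k (n : H))]
      refine Submodule.sum_mem _ fun i _ => Submodule.mul_mem_mul trivial ?_
      obtain ⟨m, hm, hmn⟩ := hn ((Module.finBasis k H).coord i)
      rw [basisRepr_right, ← hmn]
      exact hM R m (hJ hm)
    simpa [smul_smul, hε] using Submodule.smul_mem _ (counit (R := k) (n : H))⁻¹ h2
  have htop : (⊤ : Submodule k H) * M R = ⊤ := by
    rw [eq_top_iff]
    intro x _
    have h2 := Submodule.mul_mem_mul (Submodule.mem_top (R := k) (x := x)) h1
    rw [← mul_assoc] at h2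
    rw [mul_one] at h2
    exact mul_le_mul_left (le_top (a := (⊤ : Submodule k H) * ⊤)) _ h2
  have hpow : ∀ m : ℕ, (⊤ : Submodule k H) * M (R ^ m) = ⊤ := by
    intro m
    induction m with
    | zero =>
      rw [eq_top_iff]
      intro x _
      rw [← mul_one x]
      exact Submodule.mul_mem_mul trivial (hM (R ^ 0) 1 (Submodule.one_le.1 le_rfl))
    | succ m ih =>
      rw [eq_top_iff]
      calc ⊤ = ⊤ * M (R ^ m) * M R := by rw [ih, htop]
        _ = ⊤ * (M (R ^ m) * M R) := mul_assoc _ _ _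
        _ ≤ ⊤ * M (R ^ (m + 1)) := by
          refine mul_le_mul_right (Submodule.mul_le.2 ?_) _
          rintro _ ⟨a, ha, rfl⟩ _ ⟨b, hb, rfl⟩
          refine ⟨a * b, ?_, rfl⟩
          exact Ideal.mul_mem_mul ha hb
  obtain ⟨m, hm⟩ : IsNilpotent R := by
    have : IsArtinianRing N := IsArtinianRing.of_finite k N
    exact IsArtinianRing.isNilpotent_jacobson_bot
  have h0 := hpow m
  have hbot : M (R ^ m) = ⊥ := by
    rw [hm, eq_bot_iff]
    rintro _ ⟨a, ha, rfl⟩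
    have ha : a = 0 := ha
    simp [ha]
  rw [hbot, Submodule.mul_bot] at h0
  have h2 : (n : H) ∈ (⊥ : Submodule k H) := h0 ▸ trivial
  rw [Submodule.mem_bot] at h2
  exact hε (by rw [h2, map_zero])

variable [IsSemisimpleRing H] [IsAlgClosed k] [CharZero k] {l : H}

/-- The form `(a, b) ↦ λ(a b)` is nondegenerate on `N`. -/
theorem IsNormalizedIntegral.eq_zero_of_antipodeTrace_mul (hl : IsNormalizedIntegral k l)
    (hN : IsLeftCoideal N) {n : H} (hn : n ∈ N)
    (h0 : ∀ m ∈ N, antipodeTrace k H (n * m) = 0) : n = 0 := by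
  let I : Ideal N :=
    { carrier := {x | ∀ m : N, antipodeTrace k H (x * m) = 0}
      zero_mem' := fun m => by simp
      add_mem' := fun {a b} ha hb m => by
        have := ha m
        have := hb m
        simp_all [add_mul]
      smul_mem' := fun c x hx m => by
        have h1 := hx (m * c)
        have h2 := hl.antipodeTrace_comm (c : H) (x * m)
        simp only [smul_eq_mul, Subalgebra.coe_mul, mul_assoc] at h1 h2 ⊢
        rw [h2, h1] }
  -- Otherwise I would contain a nonzero idempotent f with λ(f) = 0.
  have hnil : ∀ x ∈ I, IsNilpotent x := by
    intro x hx
    by_contra hx'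
    obtain ⟨y, hy, hy0⟩ := exists_isIdempotentElem_mul (k := k) hx'
    refine hy0 (Subtype.ext (hl.eq_zero_of_isIdempotentElem (f := ((y * x : N) : H))
      congr(($hy.eq : H)) ?_))
    have := I.mul_mem_left y hx 1
    simpa using this
  -- Stability follows from x₁ λ(x₂m) = λ(xm₂) S(m₁), where m₂ stays in N.
  have hstab : ∀ x ∈ I, ∀ f : H →ₗ[k] k,
      ∃ m ∈ I, (m : H) = sliceLeft f (comul (R := k) (x : H)) := by
    intro x hx f
    refine ⟨⟨_, hN.sliceLeft_mem x.2 f⟩, fun m => ?_, rfl⟩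
    change antipodeTrace k H (sliceLeft f (comul (R := k) (x : H)) * m) = 0
    rw [← sliceLeft_mul_one_tmul, apply_sliceLeft,
      hl.sliceRight_comul_mul (basisRepr k (m : H)), map_sum]
    refine Finset.sum_eq_zero fun i _ => ?_
    have := hx ⟨_, hN.sliceLeft_mem m.2 ((Module.finBasis k H).coord i)⟩
    rw [basisRepr_right, this, zero_smul, map_zero]
  have hε : ∀ x ∈ I, counit (R := k) (x : H) = 0 := fun x hx =>
    counit_eq_zero_of_le_jacobson I (le_jacobson_bot_of_forall_isNilpotent hnil) (hstab x hx)
  refine eq_of_forall_dual (k := k) fun f => ?_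
  -- The counit kills every slice f(n₁)n₂ of n, and its value on that slice is f(n).
  obtain ⟨m, hm, hmn⟩ := hstab ⟨n, hn⟩ (fun m => h0 m m.2) f
  have h1 := hε m hm
  rw [hmn, apply_sliceLeft, sliceRight_counit_comul] at h1
  rw [h1, map_zero]

/-- For x in the radical and m in N, mx is nilpotent, so λ(xm) = 0; nondegeneracy gives x = 0. -/
theorem IsNormalizedIntegral.isSemisimpleRing_of_isLeftCoideal (hl : IsNormalizedIntegral k l)
    (hN : IsLeftCoideal N) : IsSemisimpleRing N := by
  have : IsArtinianRing N := IsArtinianRing.of_finite k N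
  rw [IsArtinianRing.isSemisimpleRing_iff_jacobson, eq_bot_iff]
  intro x hx
  rw [← Ideal.jacobson_bot] at hx
  obtain ⟨r, hr⟩ := IsArtinianRing.isNilpotent_jacobson_bot (R := N)
  refine Subtype.ext (hl.eq_zero_of_antipodeTrace_mul hN x.2 fun m hm => ?_)
  rw [hl.antipodeTrace_comm]
  refine hl.antipodeTrace_eq_zero_of_isNilpotent ⟨r, ?_⟩
  have h1 := Ideal.pow_mem_pow (Ideal.mul_mem_left _ (⟨m, hm⟩ : N) hx) r
  rw [hr] at h1
  exact congr(($h1 : H))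

/-- Functionals on `N` are of the form `λ(w ·)` with `w ∈ N`. -/
theorem IsNormalizedIntegral.exists_eq_antipodeTrace_mul (hl : IsNormalizedIntegral k l)
    (hN : IsLeftCoideal N) (φ : N →ₗ[k] k) :
    ∃ w : N, ∀ n : N, φ n = antipodeTrace k H (w * n) := by
  let F : N →ₗ[k] Module.Dual k N :=
    { toFun := fun w => antipodeTrace k H ∘ₗ LinearMap.mulLeft k (w : H) ∘ₗ N.val.toLinearMap
      map_add' := fun a b => by ext; simp [add_mul]
      map_smul' := fun c a => by ext; simp }
  have hF : Function.Injective F := by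
    refine (injective_iff_map_eq_zero F).2 fun w hw => Subtype.ext ?_
    exact hl.eq_zero_of_antipodeTrace_mul hN w.2 fun m hm => congr($hw ⟨m, hm⟩)
  obtain ⟨w, hw⟩ := (LinearMap.injective_iff_surjective_of_finrank_eq_finrank
    Subspace.dual_finrank_eq.symm).1 hF φ
  exact ⟨w, fun n => congr($hw.symm n)⟩

end CoidealSubalgebras

end SemisimpleHopf

namespace SemisimpleHopf

/-! ### The integral of N, its Casimir element and the integral of B -/

section CoidealIntegrals

open WithConv Coalgebra HopfAlgebra

variable {k : Type u} [Field k] {H : Type v} [Ring H] [HopfAlgebra k H]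

theorem dual_eq_of_forall {p q : DualAlgebra k H} (h : ∀ a, p.ofConv a = q.ofConv a) : p = q := by
  ext a
  exact h a

theorem mem_dualInvariants_iff {N : Subalgebra k H} {p : DualAlgebra k H} :
    p ∈ dualInvariants N ↔
      ∀ n ∈ N, ∀ h, p.ofConv (h * n) = counit (R := k) n * p.ofConv h :=
  forall₂_congr fun _ _ => ⟨fun hp h => congr(($hp).ofConv h), fun hp => dual_eq_of_forall hp⟩

/-- `e` is the element of `N` representing the counit of `N` through the form `λ(a b)`. -/
structure IsCoidealIntegral (N : Subalgebra k H) (e : H) : Prop where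
  mem : e ∈ N
  antipodeTrace_mul : ∀ n ∈ N, antipodeTrace k H (e * n) = counit (R := k) n

/-- `b` and `c` are dual bases of `N` for the form `λ(a b)`, and `Δ(e) = ∑ S(cᵢ) ⊗ bᵢ`. -/
structure IsCasimir (N : Subalgebra k H) (e : H) {ι : Type*} [Fintype ι] (b c : ι → N) : Prop where
  sum_left : ∀ n : N, ∑ i, antipodeTrace k H (n * b i) • c i = n
  sum_right : ∀ n : N, ∑ i, antipodeTrace k H (c i * n) • b i = n
  comul_eq : ∑ i, antipode k (c i : H) ⊗ₜ[k] (b i : H) = comul (R := k) e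

/-- The functional `λ(· w)`. -/
noncomputable def rightTranslate (w : H) : DualAlgebra k H :=
  toConv (antipodeTrace k H ∘ₗ LinearMap.mulRight k w)

theorem rightTranslate_apply (w h : H) :
    (rightTranslate (k := k) w).ofConv h = antipodeTrace k H (h * w) := rfl

theorem rightTranslate_smul (c : k) (w : H) :
    rightTranslate (k := k) (c • w) = c • rightTranslate w :=
  dual_eq_of_forall fun h => by
    rw [rightTranslate_apply, mul_smul_comm, map_smul]
    rfl

/-- The projection `h ↦ h₁ λ(h₂ e)` of `H` onto `N`. -/
noncomputable def coidealProj (k : Type u) [Field k] {H : Type v} [Ring H] [HopfAlgebra k H]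
    (e h : H) : H :=
  sliceRight (antipodeTrace k H) (comul (R := k) h * (1 ⊗ₜ[k] e))

theorem counit_coidealProj (e h : H) :
    counit (R := k) (coidealProj k e h) = antipodeTrace k H (h * e) := by
  rw [coidealProj, ← apply_sliceLeft, sliceLeft_mul_one_tmul, sliceLeft_counit_comul]

theorem mul_rightTranslate_apply (p : DualAlgebra k H) (e h : H) :
    (p * rightTranslate e).ofConv h = p.ofConv (coidealProj k e h) := by
  rw [dual_mul_apply', coidealProj, sliceRight_mul_one_tmul]
  rfl

variable {N : Subalgebra k H} {l e : H}

theorem IsCoidealIntegral.antipodeTrace_eq (he : IsCoidealIntegral N e) : antipodeTrace k H e = 1 := by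
  simpa using he.antipodeTrace_mul 1 N.one_mem

theorem IsCoidealIntegral.eq_smul_rightTranslate (he : IsCoidealIntegral N e) {q : DualAlgebra k H}
    (hint : IsDualIntegral (dualInvariants N) (rightTranslate e))
    (hq : IsDualIntegral (dualInvariants N) q) : q = q.ofConv 1 • rightTranslate e := by
  rw [← (hint.2 q hq.1).2, (hq.2 _ hint.1).1, rightTranslate_apply, one_mul, he.antipodeTrace_eq,
    one_smul]

variable [FiniteDimensional k H] [IsSemisimpleRing H] [IsAlgClosed k] [CharZero k]

theorem IsNormalizedIntegral.exists_isCoidealIntegral (hl : IsNormalizedIntegral k l)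
    (hN : IsLeftCoideal N) : ∃ e, IsCoidealIntegral N e := by
  obtain ⟨w, hw⟩ := hl.exists_eq_antipodeTrace_mul hN (counit (R := k) ∘ₗ N.val.toLinearMap)
  exact ⟨w, w.2, fun n hn => (hw ⟨n, hn⟩).symm⟩

namespace IsCoidealIntegral

theorem mul_left (he : IsCoidealIntegral N e) (hl : IsNormalizedIntegral k l)
    (hN : IsLeftCoideal N) {n : H} (hn : n ∈ N) : n * e = counit (R := k) n • e := by
  rw [← sub_eq_zero]
  refine hl.eq_zero_of_antipodeTrace_mul hN
    (N.sub_mem (N.mul_mem hn he.mem) (N.smul_mem he.mem _)) fun m hm => ?_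
  rw [sub_mul, mul_assoc, smul_mul_assoc, map_sub, map_smul, hl.antipodeTrace_comm, mul_assoc,
    he.antipodeTrace_mul _ (N.mul_mem hm hn), he.antipodeTrace_mul _ hm, Bialgebra.counit_mul,
    smul_eq_mul, mul_comm, sub_self]

/-- If ε(e) = 0 then e² = ε(e)e = 0, so λ(e) = 0; but λ(e) = ε(1) = 1. -/
theorem counit_ne_zero (he : IsCoidealIntegral N e) (hl : IsNormalizedIntegral k l)
    (hN : IsLeftCoideal N) : counit (R := k) e ≠ 0 := by
  intro h0
  have h1 := he.mul_left hl hN he.mem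
  rw [h0, zero_smul] at h1
  have h2 := hl.antipodeTrace_eq_zero_of_isNilpotent ⟨2, by rw [pow_two, h1]⟩
  rw [he.antipodeTrace_eq] at h2
  exact one_ne_zero h2

theorem coidealProj_eq_self (he : IsCoidealIntegral N e) (hl : IsNormalizedIntegral k l)
    (hN : IsLeftCoideal N) {n : H} (hn : n ∈ N) : coidealProj k e n = n := by
  refine eq_of_forall_dual (k := k) fun f => ?_
  rw [coidealProj, ← apply_sliceLeft, sliceLeft_mul_one_tmul, hl.antipodeTrace_comm,
    he.antipodeTrace_mul _ (hN.sliceLeft_mem hn f), apply_sliceLeft, sliceRight_counit_comul]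

theorem exists_isCasimir (he : IsCoidealIntegral N e) (hl : IsNormalizedIntegral k l)
    (hN : IsLeftCoideal N) : ∃ b c : Fin (Module.finrank k N) → N, IsCasimir N e b c := by
  let b := Module.finBasis k N
  choose c hc using fun i => hl.exists_eq_antipodeTrace_mul hN (b.coord i)
  have hright : ∀ n : N, ∑ i, antipodeTrace k H (c i * n) • b i = n := fun n => by
    simp only [← hc, Module.Basis.coord_apply, b.sum_repr]
  refine ⟨b, c, fun n => ?_, hright, ?_⟩
  · rw [← sub_eq_zero]
    refine Subtype.ext (hl.eq_zero_of_antipodeTrace_mul hN (Subtype.property _) fun m hm => ?_)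
    have h1 := congr(antipodeTrace k H (n * ($(hright ⟨m, hm⟩) : N)))
    simp only [AddSubmonoidClass.coe_finsetSum, Finset.mul_sum, map_sum, Subalgebra.coe_smul,
      mul_smul_comm, map_smul, smul_eq_mul] at h1
    simp only [AddSubgroupClass.coe_sub, AddSubmonoidClass.coe_finsetSum, Subalgebra.coe_smul,
      sub_mul, Finset.sum_mul, smul_mul_assoc, map_sub, map_sum, map_smul, smul_eq_mul, ← h1]
    rw [sub_eq_zero]
    exact Finset.sum_congr rfl fun i _ => mul_comm _ _
  · obtain ⟨t, ht⟩ := hN e he.mem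
    obtain ⟨a, ha⟩ : ∃ a : Fin (Module.finrank k N) → H, t = ∑ i, a i ⊗ₜ[k] b i := by
      clear ht
      induction t with
      | zero => exact ⟨0, by simp⟩
      | tmul x y =>
        refine ⟨fun i => b.repr y i • x, ?_⟩
        simp only [TensorProduct.smul_tmul, ← TensorProduct.tmul_sum, b.sum_repr]
      | add s t hs ht =>
        obtain ⟨a, rfl⟩ := hs
        obtain ⟨a', rfl⟩ := ht
        exact ⟨a + a', by simp [TensorProduct.add_tmul, Finset.sum_add_distrib]⟩
    have hcomul : comul (R := k) e = ∑ i, a i ⊗ₜ[k] (b i : H) := by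
      rw [← ht, ha]
      simp
    let r : Repr k e (Fin (Module.finrank k N)) := ⟨Finset.univ, a, fun i => b i, hcomul.symm⟩
    -- The projection fixes cⱼ, and by the exchange rule it sends cⱼ to ∑ λ(cⱼbᵢ)S(aᵢ) = S(aⱼ), the
    -- bases being dual.
    have hca : ∀ j, (c j : H) = antipode k (a j) := by
      intro j
      have h1 := he.coidealProj_eq_self hl hN (c j).2
      rw [coidealProj, hl.sliceRight_comul_mul r] at h1
      rw [← h1]
      change ∑ i, antipodeTrace k H (c j * b i) • antipode k (a i) = _
      rw [Finset.sum_eq_single j]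
      · rw [← hc]
        simp
      · intro i _ hij
        rw [← hc]
        simp [hij]
      · simp
    rw [hcomul]
    exact Finset.sum_congr rfl fun i _ => by rw [hca, hl.antipode_antipode]

theorem isDualIntegral (he : IsCoidealIntegral N e) (hl : IsNormalizedIntegral k l)
    (hN : IsLeftCoideal N) (hproj : ∀ h, coidealProj k e h ∈ N) :
    IsDualIntegral (dualInvariants N) (rightTranslate e) := by
  have hε := he.counit_ne_zero hl hN
  refine ⟨mem_dualInvariants_iff.2 fun n hn h => ?_, fun p hp => ⟨?_, ?_⟩⟩
  · rw [rightTranslate_apply, mul_assoc, he.mul_left hl hN hn, mul_smul_comm, map_smul]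
    rfl
  · refine dual_eq_of_forall fun h => ?_
    rw [mul_rightTranslate_apply, ← one_mul (coidealProj k e h),
      mem_dualInvariants_iff.1 hp _ (hproj h), counit_coidealProj, mul_comm]
    rfl
  · refine dual_eq_of_forall fun h => mul_left_cancel₀ hε ?_
    -- Here e₂ lies in N, so e₂e = ε(e₂)e. This identity lets the two factors e in λ(h₁e)p(h₂e) be
    -- exchanged for Δ(e), after which λ is applied to the coproduct of he.
    have hcomul : comul (R := k) e * (1 ⊗ₜ[k] e) = (e ⊗ₜ[k] 1) * (1 ⊗ₜ[k] e) := by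
      refine eq_of_sliceLeft_eq fun f => ?_
      rw [sliceLeft_mul_one_tmul, he.mul_left hl hN (hN.sliceLeft_mem he.mem f), apply_sliceLeft,
        sliceRight_counit_comul]
      simp
    rw [dual_mul_apply, ← mem_dualInvariants_iff.1 hp _ he.mem]
    change p.ofConv (sliceLeft (antipodeTrace k H ∘ₗ LinearMap.mulRight k e) (comul (R := k) h) *
      e) = _
    rw [← sliceLeft_mul_tmul_one, ← sliceLeft_mul_one_tmul, mul_assoc, ← hcomul, ← mul_assoc,
      ← Bialgebra.comul_mul, sliceLeft_mul_one_tmul, sliceLeft_antipodeTrace, smul_mul_assoc,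
      map_smul, mem_dualInvariants_iff.1 hp _ he.mem]
    change antipodeTrace k H (h * e) * (counit (R := k) e * p.ofConv 1) =
      counit (R := k) e * (p.ofConv 1 * antipodeTrace k H (h * e))
    ring

/-- The integral of a normal left coideal subalgebra is central in `H`. -/
theorem mul_comm (he : IsCoidealIntegral N e) (hl : IsNormalizedIntegral k l)
    (hN : IsLeftCoideal N) (hnormal : IsNormal N) (h : H) : h * e = e * h := by
  -- The adjoint of ad_a for the form λ is ad_{S(a)}, which preserves N by normality. Both sides
  -- therefore pair with m in N to ε(a)ε(m).
  have hadj : ∀ a : H, leftAdjoint k a e = counit (R := k) a • e := by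
    intro a
    rw [← sub_eq_zero]
    refine hl.eq_zero_of_antipodeTrace_mul hN
      (N.sub_mem (hnormal a e he.mem) (N.smul_mem he.mem _)) fun m hm => ?_
    have h1 : antipodeTrace k H (leftAdjoint k a e * m) =
        antipodeTrace k H (e * leftAdjoint k (antipode k a) m) := by
      rw [leftAdjoint_eq_sum (ℛ k a), leftAdjoint_eq_sum (reprAntipode (ℛ k a)), Finset.sum_mul,
        Finset.mul_sum, map_sum, map_sum]
      refine Finset.sum_congr rfl fun i _ => ?_
      rw [mul_assoc, mul_assoc, hl.antipodeTrace_comm]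
      simp only [reprAntipode_left, reprAntipode_right, hl.antipode_antipode, mul_assoc]
    rw [sub_mul, map_sub, h1, he.antipodeTrace_mul _ (hnormal _ _ hm), counit_leftAdjoint,
      counit_antipode, smul_mul_assoc, map_smul, he.antipodeTrace_mul _ hm, smul_eq_mul, sub_self]
  let f : WithConv (H →ₗ[k] H) := toConv (LinearMap.mulRight k e)
  -- Invariance becomes centrality through he = h₁eS(h₂)h₃ = ε(h₁)eh₂ = eh.
  have h1 : (f * toConv (antipode k)) * toConv LinearMap.id = f := by
    rw [mul_assoc, LinearMap.antipode_mul_id, mul_one]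
  have h2 : ∀ a, (f * toConv (antipode k)).ofConv a = counit (R := k) a • e := by
    intro a
    rw [← hadj, leftAdjoint_eq_sum (ℛ k a), (ℛ k a).convMul_apply]
    rfl
  have h3 := congr(($h1).ofConv h)
  rw [(ℛ k h).convMul_apply] at h3
  change _ = h * e at h3
  rw [← h3]
  conv_rhs => rw [← sum_counit_smul (ℛ k h), Finset.mul_sum]
  refine Finset.sum_congr rfl fun i _ => ?_
  rw [h2, smul_mul_assoc, mul_smul_comm]
  rfl

end IsCoidealIntegral

namespace IsCasimir

variable {ι : Type*} [Fintype ι] {b c : ι → N}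

theorem coidealProj_eq (hbc : IsCasimir N e b c) (hl : IsNormalizedIntegral k l) (h : H) :
    coidealProj k e h = ∑ i, antipodeTrace k H (h * b i) • (c i : H) := by
  let r : Repr k e ι := ⟨Finset.univ, fun i => antipode k (c i : H), fun i => b i, hbc.comul_eq⟩
  rw [coidealProj, hl.sliceRight_comul_mul r]
  exact Finset.sum_congr rfl fun i _ => congrArg _ (hl.antipode_antipode _)

theorem coidealProj_mem (hbc : IsCasimir N e b c) (hl : IsNormalizedIntegral k l) (h : H) :
    coidealProj k e h ∈ N := by
  rw [hbc.coidealProj_eq hl]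
  exact N.sum_mem fun i _ => N.smul_mem (c i).2 _

theorem sum_mul_tmul (hbc : IsCasimir N e b c) (hl : IsNormalizedIntegral k l) (n : N) :
    ∑ i, (n * c i) ⊗ₜ[k] b i = ∑ i, c i ⊗ₜ[k] (b i * n) := by
  have h1 : ∀ i, n * c i = ∑ j, antipodeTrace k H ((n * c i : N) * b j) • c j := fun i =>
    (hbc.sum_left _).symm
  have h2 : ∀ j, b j * n = ∑ i, antipodeTrace k H (c i * (b j * n : N)) • b i := fun j =>
    (hbc.sum_right _).symm
  conv_lhs => enter [2, i]; rw [h1 i]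
  conv_rhs => enter [2, j]; rw [h2 j]
  simp only [TensorProduct.sum_tmul, TensorProduct.tmul_sum]
  rw [Finset.sum_comm]
  refine Finset.sum_congr rfl fun j _ => Finset.sum_congr rfl fun i _ => ?_
  rw [TensorProduct.smul_tmul]
  congr 2
  rw [Subalgebra.coe_mul, Subalgebra.coe_mul, mul_assoc, hl.antipodeTrace_comm, mul_assoc]

/-- Because S² = id, the sum is S(e₁)e₂. Dividing by ε(e) ≠ 0 thus gives a separability idempotent
of N. -/
theorem sum_mul (hbc : IsCasimir N e b c) (hl : IsNormalizedIntegral k l) :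
    ∑ i, c i * b i = algebraMap k N (counit (R := k) e) := by
  let r : Repr k e ι := ⟨Finset.univ, fun i => antipode k (c i : H), fun i => b i, hbc.comul_eq⟩
  refine Subtype.ext ?_
  rw [Subalgebra.coe_algebraMap, ← sum_antipode_mul_eq_algebraMap_counit r,
    AddSubmonoidClass.coe_finsetSum]
  refine Finset.sum_congr rfl fun i _ => ?_
  change (c i : H) * b i = antipode k (antipode k (c i : H)) * b i
  rw [hl.antipode_antipode]

end IsCasimir

end CoidealIntegrals

end SemisimpleHopf

namespace SemisimpleHopf

/-! ### Characters of induced modules -/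

section InducedCharacters

open WithConv Coalgebra HopfAlgebra

variable {k : Type u} [Field k] {H : Type v} [Ring H]

theorem character_of_retract {A : Type*} [Ring A] [Algebra k A] {W Q : Type*}
    [AddCommGroup W] [Module k W] [Module A W] [IsScalarTower k A W] [FiniteDimensional k W]
    [AddCommGroup Q] [Module k Q] [Module A Q] [IsScalarTower k A Q]
    (π : W →ₗ[A] Q) (s : Q →ₗ[A] W) (hπs : ∀ q, π (s q) = q) (a : A) :
    character k A Q a = LinearMap.trace k W
      (Algebra.lsmul k k W a ∘ₗ s.restrictScalars k ∘ₗ π.restrictScalars k) := by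
  have h1 : (Algebra.lsmul k k Q a : Module.End k Q) =
      π.restrictScalars k ∘ₗ (Algebra.lsmul k k W a ∘ₗ s.restrictScalars k) := by
    ext q
    change a • q = π (a • s q)
    rw [map_smul, hπs]
  have : FiniteDimensional k Q :=
    Module.Finite.of_surjective (π.restrictScalars k) fun q => ⟨s q, hπs q⟩
  change LinearMap.trace k _ (Algebra.lsmul k k Q a) = _
  rw [h1, LinearMap.trace_comp_comm', LinearMap.comp_assoc]

section Algebra

variable [Algebra k H] {N : Subalgebra k H}
variable {ι : Type*} [Fintype ι] {b c : ι → N}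
variable (V : Type w) [AddCommGroup V] [Module k V] [Module N V] [IsScalarTower k N V]

/-- The endomorphism `h ⊗ v ↦ ∑ h cᵢ ⊗ bᵢ v` of `H ⊗ V`. -/
noncomputable def casimirEnd (b c : ι → N) : H ⊗[k] V →ₗ[H] H ⊗[k] V :=
  ∑ i, TensorProduct.AlgebraTensorModule.map (LinearMap.toSpanSingleton H H (c i : H))
    (Algebra.lsmul k k V (b i))

theorem casimirEnd_tmul (b c : ι → N) (h : H) (x : V) :
    casimirEnd V b c (h ⊗ₜ[k] x) = ∑ i, (h * c i) ⊗ₜ[k] (b i • x) := by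
  simp [casimirEnd]

theorem trace_smul_comp_casimirEnd [FiniteDimensional k H] [FiniteDimensional k V] (b c : ι → N)
    (h : H) :
    LinearMap.trace k (H ⊗[k] V)
        (Algebra.lsmul k k (H ⊗[k] V) h ∘ₗ (casimirEnd V b c).restrictScalars k) =
      ∑ i, character k N V (b i) *
        LinearMap.trace k H (LinearMap.mulLeft k h ∘ₗ LinearMap.mulRight k (c i : H)) := by
  have h1 : Algebra.lsmul k k (H ⊗[k] V) h ∘ₗ (casimirEnd V b c).restrictScalars k =
      ∑ i, TensorProduct.map (LinearMap.mulLeft k h ∘ₗ LinearMap.mulRight k (c i : H))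
        (Algebra.lsmul k k V (b i)) := by
    refine TensorProduct.ext' fun a x => ?_
    simp [casimirEnd_tmul, Finset.smul_sum, TensorProduct.smul_tmul']
  rw [h1, map_sum]
  refine Finset.sum_congr rfl fun i _ => ?_
  rw [LinearMap.trace_tensorProduct', mul_comm]
  rfl

/-- Moving n across the Casimir tensor shows that the endomorphism is balanced, so it descends to a
map from H ⊗_N V to H ⊗ V. -/
theorem balancedRelations_le_ker_casimirEnd
    (hbc : ∀ n : N, ∑ i, (n * c i) ⊗ₜ[k] b i = ∑ i, c i ⊗ₜ[k] (b i * n)) :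
    balancedRelations N V ≤ LinearMap.ker (casimirEnd V b c) := by
  refine Submodule.span_le.2 ?_
  rintro _ ⟨h, n, x, rfl⟩
  have h1 := congr(TensorProduct.map (LinearMap.mulLeft k h ∘ₗ N.val.toLinearMap)
    ((Algebra.lsmul k k V : N →ₐ[k] Module.End k V).toLinearMap.flip x) $(hbc n))
  simp only [map_sum, TensorProduct.map_tmul] at h1
  rw [SetLike.mem_coe, LinearMap.mem_ker, map_sub, sub_eq_zero, casimirEnd_tmul, casimirEnd_tmul]
  simpa [mul_assoc, mul_smul] using h1

theorem mkQ_casimirEnd (hsum : ∑ i, c i * b i = 1) (t : H ⊗[k] V) :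
    (balancedRelations N V).mkQ (casimirEnd V b c t) = (balancedRelations N V).mkQ t := by
  induction t with
  | zero => simp
  | tmul h x =>
    have h1 : ∀ i, (balancedRelations N V).mkQ ((h * c i) ⊗ₜ[k] (b i • x)) =
        (balancedRelations N V).mkQ ((h * (c i * b i : N)) ⊗ₜ[k] x) := by
      intro i
      symm
      rw [← sub_eq_zero, ← map_sub, Submodule.mkQ_apply, Submodule.Quotient.mk_eq_zero]
      refine Submodule.subset_span ⟨h * c i, b i, x, ?_⟩
      rw [Subalgebra.coe_mul, mul_assoc]
    rw [casimirEnd_tmul, map_sum, Finset.sum_congr rfl fun i _ => h1 i, ← map_sum,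
      ← TensorProduct.sum_tmul, ← Finset.mul_sum, ← AddSubmonoidClass.coe_finsetSum, hsum,
      Subalgebra.coe_one, mul_one]
  | add s t hs ht => rw [map_add, map_add, map_add, hs, ht]

/-- The descended endomorphism splits the quotient map H ⊗ V → H ⊗_N V. The character is thus the
trace on H ⊗ V of h composed with the resulting projector, a sum of products of traces. -/
theorem character_inducedModule [FiniteDimensional k H] [FiniteDimensional k V]
    (hbc : ∀ n : N, ∑ i, (n * c i) ⊗ₜ[k] b i = ∑ i, c i ⊗ₜ[k] (b i * n))
    (hsum : ∑ i, c i * b i = 1) (h : H) :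
    character k H (InducedModule N V) h =
      ∑ i, character k N V (b i) *
        LinearMap.trace k H (LinearMap.mulLeft k h ∘ₗ LinearMap.mulRight k (c i : H)) := by
  rw [← trace_smul_comp_casimirEnd]
  let π : H ⊗[k] V →ₗ[H] InducedModule N V := (balancedRelations N V).mkQ
  let s : InducedModule N V →ₗ[H] H ⊗[k] V :=
    (balancedRelations N V).liftQ (casimirEnd V b c) (balancedRelations_le_ker_casimirEnd V hbc)
  have hsπ : ∀ t, s (π t) = casimirEnd V b c t := fun t => Submodule.liftQ_apply _ _ _
  have hπs : ∀ q, π (s q) = q := by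
    intro q
    obtain ⟨t, rfl⟩ := (balancedRelations N V).mkQ_surjective q
    exact (congrArg π (hsπ t)).trans (mkQ_casimirEnd V hsum t)
  have h2 : (casimirEnd V b c).restrictScalars k =
      s.restrictScalars k ∘ₗ π.restrictScalars k := by
    refine LinearMap.ext fun t => ?_
    exact (hsπ t).symm
  rw [h2]
  exact character_of_retract π s hπs h

end Algebra

variable [HopfAlgebra k H] {N : Subalgebra k H} {l e : H} {ι : Type*} [Fintype ι] {b c : ι → N}

/-- The element `w` of `N` such that `λ(· w)` is the function induced from `φ`. -/
noncomputable def inductionElement (l e : H) (b c : ι → N) : (N →ₗ[k] k) →ₗ[k] H :=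
  ∑ i, (LinearMap.applyₗ (b i)).smulRight
    ((counit (R := k) e)⁻¹ • leftAdjoint k l (c i : H))

theorem inductionElement_apply (φ : N →ₗ[k] k) :
    inductionElement l e b c φ =
      (counit (R := k) e)⁻¹ • ∑ i, φ (b i) • leftAdjoint k l (c i : H) := by
  rw [Finset.smul_sum, inductionElement, LinearMap.sum_apply]
  exact Finset.sum_congr rfl fun i _ => smul_comm _ _ _

/-- The induction of functions from `N` to `H`. -/
noncomputable def induction (l e : H) (b c : ι → N) : (N →ₗ[k] k) →ₗ[k] DualAlgebra k H where
  toFun φ := rightTranslate (inductionElement l e b c φ)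
  map_add' φ ψ := dual_eq_of_forall fun h => by
    rw [map_add, rightTranslate_apply, mul_add, map_add]
    rfl
  map_smul' a φ := by rw [map_smul, rightTranslate_smul, RingHom.id_apply]

theorem induction_apply (φ : N →ₗ[k] k) :
    induction l e b c φ = rightTranslate (inductionElement l e b c φ) := rfl

theorem inductionElement_mem (hnormal : IsNormal N) (φ : N →ₗ[k] k) :
    inductionElement l e b c φ ∈ N := by
  rw [inductionElement_apply]
  exact N.smul_mem (N.sum_mem fun i _ => N.smul_mem (hnormal l _ (c i).2) _) _

theorem IsCharacterInduction.unique {ind ind' : characterSpace k N →ₗ[k] DualAlgebra k H}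
    (h : IsCharacterInduction N ind) (h' : IsCharacterInduction N ind') : ind = ind' := by
  have key : ∀ (f : N →ₗ[k] k) (hf : f ∈ characterSpace k N), ind ⟨f, hf⟩ = ind' ⟨f, hf⟩ := by
    intro f hf
    induction hf using Submodule.span_induction with
    | mem f hf =>
      obtain ⟨V, _, _, _, _, _, _, rfl⟩ := hf
      exact (h V).trans (h' V).symm
    | zero => exact (map_zero ind).trans (map_zero ind').symm
    | add f g hf hg h1 h2 =>
      exact (map_add ind ⟨f, hf⟩ ⟨g, hg⟩).trans
        ((congrArg₂ _ h1 h2).trans (map_add ind' ⟨f, hf⟩ ⟨g, hg⟩).symm)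
    | smul a f hf h1 =>
      exact (map_smul ind a ⟨f, hf⟩).trans
        ((congrArg _ h1).trans (map_smul ind' a ⟨f, hf⟩).symm)
  exact LinearMap.ext fun f => key f f.2

theorem IsNormalizedIntegral.inductionElement_comm (hl : IsNormalizedIntegral k l)
    (φ : N →ₗ[k] k) (h : H) :
    h * inductionElement l e b c φ = inductionElement l e b c φ * h := by
  rw [inductionElement_apply]
  simp only [mul_smul_comm, smul_mul_assoc, Finset.mul_sum, Finset.sum_mul, hl.leftAdjoint_comm]

variable [FiniteDimensional k H] [IsSemisimpleRing H] [IsAlgClosed k] [CharZero k]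

namespace IsCasimir

theorem induction_character (hbc : IsCasimir N e b c) (hl : IsNormalizedIntegral k l)
    (he : IsCoidealIntegral N e) (hN : IsLeftCoideal N)
    (V : Type w) [AddCommGroup V] [Module k V] [Module N V] [IsScalarTower k N V]
    [FiniteDimensional k V] :
    induction l e b c (character k N V) = toConv (character k H (InducedModule N V)) := by
  have hε := he.counit_ne_zero hl hN
  refine dual_eq_of_forall fun h => ?_
  let c' : ι → N := fun i => (counit (R := k) e)⁻¹ • c i
  have h1 : ∀ n : N, ∑ i, (n * c' i) ⊗ₜ[k] b i = ∑ i, c' i ⊗ₜ[k] (b i * n) := by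
    intro n
    simp only [c', mul_smul_comm, ← TensorProduct.smul_tmul', ← Finset.smul_sum,
      hbc.sum_mul_tmul hl]
  have h2 : ∑ i, c' i * b i = 1 := by
    simp only [c', smul_mul_assoc, ← Finset.smul_sum, hbc.sum_mul hl]
    rw [Algebra.algebraMap_eq_smul_one, smul_smul, inv_mul_cancel₀ hε, one_smul]
  change _ = character k H (InducedModule N V) h
  rw [character_inducedModule V h1 h2, induction_apply, rightTranslate_apply,
    inductionElement_apply, mul_smul_comm, map_smul, Finset.mul_sum, map_sum, smul_eq_mul,
    Finset.mul_sum]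
  refine Finset.sum_congr rfl fun i _ => ?_
  have h3 : LinearMap.mulRight k (c' i : H) =
      (counit (R := k) e)⁻¹ • LinearMap.mulRight k (c i : H) := by
    ext x
    simp [c']
  rw [h3, LinearMap.comp_smul, map_smul, hl.trace_mulLeft_comp_mulRight_eq, mul_smul_comm, map_smul,
    smul_eq_mul, smul_eq_mul]
  ring

theorem isCharacterInduction (hbc : IsCasimir N e b c) (hl : IsNormalizedIntegral k l)
    (he : IsCoidealIntegral N e) (hN : IsLeftCoideal N) :
    IsCharacterInduction N (induction l e b c ∘ₗ (characterSpace k N).subtype) :=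
  fun V _ _ _ _ _ _ => hbc.induction_character hl he hN V

/-- The functional φ = λ(w ·) is a trace function on N since w is central. By the dual bases ∑
φ(bᵢ)cᵢ = w, and ad_Λ fixes the central element w; the factor ε(e) cancels the normalization. -/
theorem exists_inductionElement_eq (hbc : IsCasimir N e b c) (hl : IsNormalizedIntegral k l)
    (he : IsCoidealIntegral N e) (hN : IsLeftCoideal N) {w : H} (hw : w ∈ N)
    (hcomm : ∀ h, h * w = w * h) :
    ∃ φ ∈ characterSpace k N, inductionElement l e b c φ = w := by
  have hε := he.counit_ne_zero hl hN
  have := hl.isSemisimpleRing_of_isLeftCoideal hN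
  let φ : N →ₗ[k] k := antipodeTrace k H ∘ₗ LinearMap.mulLeft k w ∘ₗ N.val.toLinearMap
  have hφ : ∀ n : N, φ n = antipodeTrace k H (w * n) := fun _ => rfl
  have hφmem : φ ∈ characterSpace k N := by
    refine mem_characterSpace_of_mul_comm fun x y => ?_
    rw [hφ, hφ, Subalgebra.coe_mul, Subalgebra.coe_mul, ← mul_assoc, ← hcomm, mul_assoc,
      hl.antipodeTrace_comm, mul_assoc]
  refine ⟨counit (R := k) e • φ, Submodule.smul_mem _ _ hφmem, ?_⟩
  have hadd : ∀ f : ι → k, ∑ i, f i • leftAdjoint k l (c i : H) =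
      leftAdjoint k l (∑ i, f i • (c i : H)) := by
    intro f
    simp only [leftAdjoint_eq_sum (ℛ k l), Finset.smul_sum, Finset.mul_sum, Finset.sum_mul,
      mul_smul_comm, smul_mul_assoc]
    exact Finset.sum_comm
  rw [map_smul, inductionElement_apply, smul_smul, mul_inv_cancel₀ hε, one_smul, hadd]
  have h1 := congr((($(hbc.sum_left ⟨w, hw⟩) : N) : H))
  rw [AddSubmonoidClass.coe_finsetSum] at h1
  have h2 : ∑ i, φ (b i) • (c i : H) = w := h1
  rw [h2, hl.leftAdjoint_eq_self hcomm]

end IsCasimir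

end InducedCharacters

end SemisimpleHopf

namespace SemisimpleHopf

/-! ### The three descriptions of the space of induced characters -/

section CharacterAlgebra

open WithConv Coalgebra HopfAlgebra

variable {k : Type u} [Field k] {H : Type v} [Ring H] [HopfAlgebra k H]

theorem mul_apply_mul_comm {p q : DualAlgebra k H}
    (hp : ∀ a b, p.ofConv (a * b) = p.ofConv (b * a))
    (hq : ∀ a b, q.ofConv (a * b) = q.ofConv (b * a)) (a b : H) :
    (p * q).ofConv (a * b) = (p * q).ofConv (b * a) := by
  have key : ∀ s t : H ⊗[k] H,
      q.ofConv (sliceLeft p.ofConv (s * t)) = q.ofConv (sliceLeft p.ofConv (t * s)) := by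
    intro s t
    induction s with
    | zero => simp
    | tmul x y =>
      induction t with
      | zero => simp
      | tmul x' y' => simp [hp x, hq y]
      | add s t hs ht => rw [add_mul, mul_add, map_add, map_add, map_add, map_add, hs, ht]
    | add s s' hs hs' => rw [add_mul, mul_add, map_add, map_add, map_add, map_add, hs, hs']
  rw [dual_mul_apply, dual_mul_apply, Bialgebra.comul_mul, Bialgebra.comul_mul, key]

variable [FiniteDimensional k H] [IsSemisimpleRing H] [IsAlgClosed k]

theorem mem_characterAlgebra_iff {p : DualAlgebra k H} :
    p ∈ characterAlgebra k H ↔ ∀ a b, p.ofConv (a * b) = p.ofConv (b * a) :=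
  ⟨fun h => mul_comm_of_mem_characterSpace h, fun h => mem_characterSpace_of_mul_comm h⟩

theorem mul_mem_characterAlgebra {p q : DualAlgebra k H} (hp : p ∈ characterAlgebra k H)
    (hq : q ∈ characterAlgebra k H) : p * q ∈ characterAlgebra k H :=
  mem_characterAlgebra_iff.2
    (mul_apply_mul_comm (mem_characterAlgebra_iff.1 hp) (mem_characterAlgebra_iff.1 hq))

variable [CharZero k] {N : Subalgebra k H} {l e : H}

namespace IsNormalizedIntegral

theorem exists_eq_rightTranslate (hl : IsNormalizedIntegral k l) (p : DualAlgebra k H) :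
    ∃ w, p = rightTranslate w := by
  obtain ⟨w, hw⟩ := hl.exists_eq_antipodeTrace_mulLeft p.ofConv
  refine ⟨w, dual_eq_of_forall fun h => ?_⟩
  rw [hw, rightTranslate_apply, hl.antipodeTrace_comm]
  rfl

theorem rightTranslate_mem_characterAlgebra_iff (hl : IsNormalizedIntegral k l) {w : H} :
    rightTranslate w ∈ characterAlgebra k H ↔ ∀ h, h * w = w * h := by
  rw [mem_characterAlgebra_iff]
  constructor
  · refine fun hw a => hl.antipodeTrace_mulLeft_injective fun y => ?_
    have h1 := hw y a
    rw [rightTranslate_apply, rightTranslate_apply, mul_assoc, mul_assoc,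
      hl.antipodeTrace_comm y, hl.antipodeTrace_comm a, mul_assoc y] at h1
    rw [h1, hl.antipodeTrace_comm, mul_assoc]
  · intro hw a b
    rw [rightTranslate_apply, rightTranslate_apply, mul_assoc, hl.antipodeTrace_comm, mul_assoc b,
      mul_assoc, hw a]

/-- `s(x) ⇀ h = λ(S(w₁) h) w₂` for `x = λ(· w)`. -/
theorem hit_dualAntipode_rightTranslate (hl : IsNormalizedIntegral k l) (w h : H) :
    hit (dualAntipode (rightTranslate (k := k) w)) h =
      sliceLeft (antipodeTrace k H ∘ₗ LinearMap.mulRight k h ∘ₗ antipode k)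
        (comul (R := k) w) := by
  have h1 : (dualAntipode (rightTranslate (k := k) w)).ofConv =
      antipodeTrace k H ∘ₗ LinearMap.mulLeft k (antipode k w) := by
    ext y
    change antipodeTrace k H (antipode k y * w) = antipodeTrace k H (antipode k w * y)
    rw [← hl.antipodeTrace_antipode, antipode_mul_antidistrib, hl.antipode_antipode]
  change sliceRight (dualAntipode (rightTranslate (k := k) w)).ofConv (comul (R := k) h) = _
  rw [h1, ← sliceRight_one_tmul_mul, hl.sliceRight_mul_comul (reprAntipode (ℛ k w)),
    sliceLeft_comul (ℛ k w)]
  exact Finset.sum_congr rfl fun i _ => congrArg _ (hl.antipode_antipode _)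

/-- At h = Λ the hit action returns w itself, since λ(S(y)Λ) = ε(y). Conversely, the right legs of
Δ(w) lie in N when w does. -/
theorem hit_dualAntipode_mem_iff (hl : IsNormalizedIntegral k l) (hN : IsLeftCoideal N) {w : H} :
    (∀ h, hit (dualAntipode (rightTranslate (k := k) w)) h ∈ N) ↔ w ∈ N := by
  constructor
  · intro h
    have h1 := h l
    have h2 : antipodeTrace k H ∘ₗ LinearMap.mulRight k l ∘ₗ antipode k = counit := by
      ext y
      change antipodeTrace k H (antipode k y * l) = _
      rw [hl.mul_left, counit_antipode, map_smul, hl.antipodeTrace_eq, smul_eq_mul, mul_one]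
    rwa [hl.hit_dualAntipode_rightTranslate, h2, sliceLeft_counit_comul] at h1
  · intro hw h
    rw [hl.hit_dualAntipode_rightTranslate]
    exact hN.sliceLeft_mem hw _

end IsNormalizedIntegral

variable (k N) in
/-- The functionals `λ(· w)` with `w ∈ N` central in `H`. -/
def centralTranslates : Set (DualAlgebra k H) :=
  {p | ∃ w ∈ N, (∀ h, h * w = w * h) ∧ p = rightTranslate w}

theorem IsNormalizedIntegral.setOf_hit_dualAntipode_mem (hl : IsNormalizedIntegral k l)
    (hN : IsLeftCoideal N) :
    {x | x ∈ characterAlgebra k H ∧ ∀ h, hit (dualAntipode x) h ∈ N} = centralTranslates k N := by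
  ext p
  constructor
  · rintro ⟨hp, hmem⟩
    obtain ⟨w, rfl⟩ := hl.exists_eq_rightTranslate p
    exact ⟨w, (hl.hit_dualAntipode_mem_iff hN).1 hmem,
      hl.rightTranslate_mem_characterAlgebra_iff.1 hp, rfl⟩
  · rintro ⟨w, hw, hcomm, rfl⟩
    exact ⟨hl.rightTranslate_mem_characterAlgebra_iff.2 hcomm,
      (hl.hit_dualAntipode_mem_iff hN).2 hw⟩

namespace IsCasimir

variable {ι : Type*} [Fintype ι] {b c : ι → N}

theorem range_induction (hbc : IsCasimir N e b c) (hl : IsNormalizedIntegral k l)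
    (he : IsCoidealIntegral N e) (hN : IsLeftCoideal N) (hnormal : IsNormal N) :
    Set.range (induction l e b c ∘ₗ (characterSpace k N).subtype) = centralTranslates k N := by
  ext p
  constructor
  · rintro ⟨φ, rfl⟩
    exact ⟨_, inductionElement_mem hnormal φ.1, hl.inductionElement_comm φ.1, rfl⟩
  · rintro ⟨w, hw, hcomm, rfl⟩
    obtain ⟨φ, hφ, rfl⟩ := hbc.exists_inductionElement_eq hl he hN hw hcomm
    exact ⟨⟨φ, hφ⟩, rfl⟩

/-- Expanding the projection onto N in the dual bases moves it from the argument h to w; `sum_right`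
says that the resulting map of w is the identity on N. -/
theorem rightTranslate_mul_rightTranslate (hbc : IsCasimir N e b c)
    (hl : IsNormalizedIntegral k l) (w : H) :
    rightTranslate w * rightTranslate e =
      rightTranslate (k := k) ((∑ i, antipodeTrace k H (c i * w) • b i : N) : H) := by
  refine dual_eq_of_forall fun h => ?_
  rw [mul_rightTranslate_apply, hbc.coidealProj_eq hl, rightTranslate_apply, rightTranslate_apply,
    AddSubmonoidClass.coe_finsetSum, Finset.sum_mul, Finset.mul_sum, map_sum, map_sum]
  refine Finset.sum_congr rfl fun i _ => ?_
  rw [smul_mul_assoc, Subalgebra.coe_smul, mul_smul_comm, map_smul, map_smul, smul_eq_mul,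
    smul_eq_mul, mul_comm]

theorem setOf_mul_integral (hbc : IsCasimir N e b c) (hl : IsNormalizedIntegral k l)
    (he : IsCoidealIntegral N e) (hN : IsLeftCoideal N) (hnormal : IsNormal N) {a : k}
    (ha : a ≠ 0) :
    {y | ∃ x ∈ characterAlgebra k H, y = x * (a • rightTranslate e)} = centralTranslates k N := by
  have hsmul : ∀ x : DualAlgebra k H, x * (a • rightTranslate e) = a • (x * rightTranslate e) :=
    fun x => mul_smul_comm a x _
  ext p
  constructor
  · rintro ⟨x, hx, rfl⟩
    -- Centrality of the projected element is obtained indirectly: λ(· e) is a class function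
    -- because e is central, and products of class functions are class functions.
    have h1 := (characterAlgebra k H).smul_mem a (mul_mem_characterAlgebra hx
      (hl.rightTranslate_mem_characterAlgebra_iff.2 (he.mul_comm hl hN hnormal)))
    obtain ⟨w, rfl⟩ := hl.exists_eq_rightTranslate x
    rw [hbc.rightTranslate_mul_rightTranslate hl, ← rightTranslate_smul,
      hl.rightTranslate_mem_characterAlgebra_iff] at h1
    refine ⟨_, N.smul_mem (Subtype.property _) a, h1, ?_⟩
    rw [hsmul, hbc.rightTranslate_mul_rightTranslate hl, rightTranslate_smul]
  · rintro ⟨w, hw, hcomm, rfl⟩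
    refine ⟨a⁻¹ • rightTranslate w, (characterAlgebra k H).smul_mem _
      (hl.rightTranslate_mem_characterAlgebra_iff.2 hcomm), ?_⟩
    rw [smul_mul_assoc, hsmul, smul_smul, inv_mul_cancel₀ ha, one_smul,
      hbc.rightTranslate_mul_rightTranslate hl]
    exact congrArg (fun n : N => rightTranslate (n : H)) (hbc.sum_right ⟨w, hw⟩).symm

end IsCasimir

end CharacterAlgebra

end SemisimpleHopf

theorem mainTheorem3 {k : Type u} [Field k] [IsAlgClosed k] [CharZero k]
    {H : Type v} [Ring H] [HopfAlgebra k H] [IsSemisimpleRing H]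
    (N : Subalgebra k H) (hN : SemisimpleHopf.IsLeftCoideal N)
    (hnormal : SemisimpleHopf.IsNormal N) :
    (∃! ind : SemisimpleHopf.characterSpace k N →ₗ[k] SemisimpleHopf.DualAlgebra k H,
      SemisimpleHopf.IsCharacterInduction N ind) ∧
    (∃ l : SemisimpleHopf.DualAlgebra k H,
      l ≠ 0 ∧ SemisimpleHopf.IsDualIntegral (SemisimpleHopf.dualInvariants N) l) ∧
    ∀ ind : SemisimpleHopf.characterSpace k N →ₗ[k] SemisimpleHopf.DualAlgebra k H,
      SemisimpleHopf.IsCharacterInduction N ind →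
      ∀ l : SemisimpleHopf.DualAlgebra k H,
        l ≠ 0 → SemisimpleHopf.IsDualIntegral (SemisimpleHopf.dualInvariants N) l →
        Set.range ind = {y | ∃ x ∈ SemisimpleHopf.characterAlgebra k H, y = x * l} ∧
        {y | ∃ x ∈ SemisimpleHopf.characterAlgebra k H, y = x * l} =
          {x | x ∈ SemisimpleHopf.characterAlgebra k H ∧
            ∀ h : H, SemisimpleHopf.hit (SemisimpleHopf.dualAntipode x) h ∈ N} := by
  obtain ⟨L, hL⟩ := SemisimpleHopf.exists_isNormalizedIntegral k H
  have := hL.finiteDimensional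
  obtain ⟨e, he⟩ := hL.exists_isCoidealIntegral hN
  obtain ⟨b, c, hbc⟩ := he.exists_isCasimir hL hN
  have hind := hbc.isCharacterInduction hL he hN
  have hint := he.isDualIntegral hL hN (hbc.coidealProj_mem hL)
  refine ⟨⟨_, hind, fun ind h => h.unique hind⟩, ⟨_, fun h0 => ?_, hint⟩,
    fun ind h l hl0 hl => ?_⟩
  · have h1 := congr(($h0).ofConv 1)
    rw [SemisimpleHopf.rightTranslate_apply, one_mul, he.antipodeTrace_eq] at h1
    exact one_ne_zero h1
  · obtain rfl := h.unique hind
    have hl' := he.eq_smul_rightTranslate hint hl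
    have ha : l.ofConv 1 ≠ 0 := fun h0 => hl0 (by rw [hl', h0, zero_smul])
    rw [hl', hbc.setOf_mul_integral hL he hN hnormal ha, hL.setOf_hit_dualAntipode_mem hN]
    exact ⟨hbc.range_induction hL he hN hnormal, rfl⟩
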